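/- Fix a smooth, nonnegative, radial function $\varphi:\mathbb R^5\to\mathbb R$ supported in $\{\tfrac34<|\xi|<\tfrac83\}$ with $\sum_{j\in\mathbb Z}\varphi(2^{-j}\xi)=1$ for all $\xi\neq 0$, and put $\varphi_j(\xi)=\varphi(2^{-j}\xi)$. For a tempered distribution $f$ on $\mathbb R^5$ let $f_j$ be the tempered distribution with $\widehat{f_j}(\xi)=\varphi_j(\xi)\widehat f(\xi)$, and let $e^{it\Delta^2}$ be the Fourier multiplier operator with symbol $e^{it|\xi|^4}$ (Fourier transform with kernel $e^{-ix\cdot\xi}$). Then there is a constant $C>0$, depending only on $\varphi$, such that for all $1\le p\le 2$, $t>1$, $j\in\mathbb Z$ and all tempered distributions $f$, $$\|e^{it\Delta^2}f_j\|_{L^{p'}(\mathbb R^5)}\le C\,2^{-\frac{5(2-p)j}{p}}\,t^{-\frac{5(2-p)}{2p}}\,\|f_j\|_{L^p(\mathbb R^5)},\qquad p'=\frac{p}{p-1}\quad(p'=\infty\text{ if }p=1).$$ Here the $L^q$ norm of a tempered distribution is $\infty$ if it is not given by an $L^q$ function; in particular, if $f_j\in L^p$, then $e^{it\Delta^2}f_j\in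 L^{p'}$. -/

import Mathlib

open MeasureTheory
open scoped SchwartzMap ENNReal ContDiff

/-- Five-dimensional Euclidean space. -/
abbrev R5 : Type := EuclideanSpace ℝ (Fin 5)

/-- A Littlewood–Paley function on `ℝ⁵`: smooth, nonnegative, radial, supported in the annulus
`3/4 < |ξ| < 8/3`, whose dyadic dilates form a partition of unity away from the origin. -/
structure IsLittlewoodPaley (φ : R5 → ℝ) : Prop where
  smooth : ContDiff ℝ ∞ φ
  nonneg : ∀ ξ, 0 ≤ φ ξ
  radial : ∀ ξ η : R5, ‖ξ‖ = ‖η‖ → φ ξ = φ η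
  support_subset : ∀ ξ, φ ξ ≠ 0 → 3 / 4 < ‖ξ‖ ∧ ‖ξ‖ < 8 / 3
  sum_eq_one : ∀ ξ : R5, ξ ≠ 0 → HasSum (fun j : ℤ => φ ((2 : ℝ) ^ (-j) • ξ)) 1

/-- The Fourier multiplier operator with symbol `m` in the angular frequency variable `ξ`, i.e.
for the Fourier transform with kernel `e^{-i x·ξ}`, acting on tempered distributions. Mathlib's
Fourier transform has kernel `e^{-2πi x·ξ}`, hence the rescaling of the symbol by `2π`. -/
noncomputable def angularMultiplier (m : R5 → ℂ) (f : 𝓢'(R5, ℂ)) : 𝓢'(R5, ℂ) :=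
  TemperedDistribution.fourierMultiplierCLM ℂ (fun ξ : R5 => m ((2 * Real.pi) • ξ)) f

/-- The symbol `φ_j(ξ) = φ(ξ / 2^j)`. -/
noncomputable def dyadicSymbol (φ : R5 → ℝ) (j : ℤ) (ξ : R5) : ℂ :=
  ((φ ((2 : ℝ) ^ (-j) • ξ) : ℝ) : ℂ)

/-- The frequency-localized piece `f_j`, with Fourier transform `φ_j(ξ) f̂(ξ)`. -/
noncomputable def dyadicPiece (φ : R5 → ℝ) (j : ℤ) (f : 𝓢'(R5, ℂ)) : 𝓢'(R5, ℂ) :=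
  angularMultiplier (dyadicSymbol φ j) f

/-- The symbol `e^{it|ξ|⁴}` of the free fourth-order Schrödinger group. -/
noncomputable def biharmonicSymbol (t : ℝ) (ξ : R5) : ℂ :=
  Complex.exp (((t * ‖ξ‖ ^ 4 : ℝ) : ℂ) * Complex.I)

/-- The free fourth-order Schrödinger evolution `e^{itΔ²} f`, with Fourier transform
`e^{it|ξ|⁴} f̂(ξ)`. -/
noncomputable def biharmonicFlow (t : ℝ) (f : 𝓢'(R5, ℂ)) : 𝓢'(R5, ℂ) :=
  angularMultiplier (biharmonicSymbol t) f

/-- The tempered distribution `T` is (integration against) the function `g ∈ L^p`. -/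
def IsLpRepresentative (p : ℝ≥0∞) (T : 𝓢'(R5, ℂ)) (g : R5 → ℂ) : Prop :=
  MemLp g p volume ∧ ∀ u : 𝓢(R5, ℂ), T u = ∫ x, u x • g x

/-- The `L^p` norm (`1 ≤ p ≤ ∞`) of a tempered distribution: the `L^p` norm of the function that
represents it (which is unique up to null sets), and `∞` if it is not an `L^p` function. -/
noncomputable def distLpNorm (p : ℝ≥0∞) (T : 𝓢'(R5, ℂ)) : ℝ≥0∞ :=
  ⨅ (g : R5 → ℂ) (_ : IsLpRepresentative p T g), eLpNorm g p volume

/-! Both symbols have temperate growth, so that the multiplier operators above are the genuine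
ones (Mathlib's multiplication operator has a default value at other symbols). -/

theorem hasTemperateGrowth_cexp_mul_I :
    (fun x : ℝ => Complex.exp ((x : ℂ) * Complex.I)).HasTemperateGrowth := by
  have hd : ∀ n : ℕ, iteratedDeriv n (fun x : ℝ => Complex.exp ((x : ℂ) * Complex.I)) =
      fun x : ℝ => Complex.I ^ n * Complex.exp ((x : ℂ) * Complex.I) := by
    intro n
    induction n with
    | zero => simp
    | succ n ih =>
      rw [iteratedDeriv_succ, ih]
      funext x
      have h1 : HasDerivAt (fun x : ℝ => (x : ℂ) * Complex.I) (1 * Complex.I) x :=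
        (Complex.ofRealCLM.hasDerivAt (x := x)).mul_const Complex.I
      have h2 := (h1.cexp).const_mul (Complex.I ^ n)
      rw [h2.deriv]
      ring
  refine ⟨((Complex.ofRealCLM.contDiff).mul contDiff_const).cexp, fun n => ⟨0, 1, fun x => ?_⟩⟩
  rw [norm_iteratedFDeriv_eq_norm_iteratedDeriv, hd n]
  simp [Complex.norm_exp_ofReal_mul_I]

theorem hasTemperateGrowth_biharmonicSymbol (t : ℝ) :
    (fun ξ : R5 => biharmonicSymbol t ((2 * Real.pi) • ξ)).HasTemperateGrowth := by
  have h : (fun ξ : R5 => (t * (2 * Real.pi) ^ 4) * (‖ξ‖ ^ 2) ^ 2).HasTemperateGrowth :=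
    (Function.HasTemperateGrowth.const _).mul
      ((Function.hasTemperateGrowth_norm_sq R5).pow 2)
  have h2 := hasTemperateGrowth_cexp_mul_I.comp h
  convert h2 using 1
  funext ξ
  simp only [biharmonicSymbol, Function.comp, norm_smul, Real.norm_eq_abs]
  rw [abs_of_pos (by positivity)]
  congr 3
  ring

theorem hasTemperateGrowth_dyadicSymbol {φ : R5 → ℝ} (hφ : IsLittlewoodPaley φ) (j : ℤ) :
    (fun ξ : R5 => dyadicSymbol φ j ((2 * Real.pi) • ξ)).HasTemperateGrowth := by
  have hs : HasCompactSupport φ := by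
    refine HasCompactSupport.of_support_subset_isCompact
      (isCompact_closedBall (0 : R5) (8 / 3)) fun ξ hξ => ?_
    simpa using (hφ.support_subset ξ hξ).2.le
  have h := Complex.ofRealCLM.hasTemperateGrowth.comp
    ((hs.hasTemperateGrowth hφ.smooth).comp
      (((2 : ℝ) ^ (-j) * (2 * Real.pi)) • ContinuousLinearMap.id ℝ R5).hasTemperateGrowth)
  convert h using 1
  funext ξ
  simp [dyadicSymbol, smul_smul]

/-! Let `χ` be a smooth cutoff to an annulus, equal to `1` on the support of `φ`. On `f_j` the flow
is convolution with a Schwartz kernel `K` whose Fourier transform is `e^{it|ξ|⁴} χ(2^{-j}ξ)`. That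
symbol is bounded by `1`, so Plancherel gives `L² → L²` with norm at most `1`. A bound `|K| ≤ A`
gives `L¹ → L^∞` with norm at most `A`. Riesz–Thorin then gives `L^p → L^{p'}` with norm at most
`A^{(2-p)/p}`, and it remains to show `A ≲ 2^{-5j} t^{-5/2}`.

Rescaling frequencies by `2^j` turns `K` into `2^{5j}` times an oscillatory integral with phase `⟨v,
w⟩ + T|w|⁴`, `T = t 2^{4j}`, so decay `T^{-5/2}` uniform in `v` suffices
(`exists_norm_integral_quartic_phase_le`). Squaring replaces stationary phase: the square of the
integral is an integral over `η` of correlations of the integrand at `m ± η/2`. There the linear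
phase becomes a unimodular constant, and the remaining phase `T(|m+η/2|⁴ - |m-η/2|⁴)` has derivative
at least `T|η|` in direction `η/|η|` as long as both points lie in the annulus. Repeated integration
by parts bounds the correlation by `(1 + T|η|)^{-6}`; integrating over `η` gives `T^{-5}`, and a
square root finishes. -/

/-! ### Riesz–Thorin interpolation on simple functions. -/

/-- The value at `c` of the analytic family of powers used in the Riesz–Thorin argument: the phase
of `c` times `|c| ^ (p * (1 - z / 2))`. -/
noncomputable def analyticPower (p : ℝ) (z c : ℂ) : ℂ :=
  if c = 0 then 0 else c / ‖c‖ * Complex.exp (p * (1 - z / 2) * Real.log ‖c‖)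

theorem analyticPower_zero (p : ℝ) (z : ℂ) : analyticPower p z 0 = 0 := by simp [analyticPower]

theorem norm_analyticPower {p : ℝ} {z c : ℂ} (h : p * (1 - z.re / 2) ≠ 0) :
    ‖analyticPower p z c‖ = ‖c‖ ^ (p * (1 - z.re / 2)) := by
  by_cases hc : c = 0
  · simp [analyticPower, hc, Real.zero_rpow h]
  · have hc' : 0 < ‖c‖ := norm_pos_iff.2 hc
    rw [analyticPower, if_neg hc, norm_mul, norm_div, Complex.norm_real, norm_norm,
      div_self hc'.ne', one_mul, Complex.norm_exp, Real.rpow_def_of_pos hc']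
    congr 1
    have : (p * (1 - z / 2) * Real.log ‖c‖ : ℂ) =
        ((p * Real.log ‖c‖ : ℝ) : ℂ) * (1 - z / 2) := by push_cast; ring
    rw [this, Complex.re_ofReal_mul]
    simp
    ring

theorem norm_analyticPower_le {p : ℝ} (hp : 0 ≤ p) {z : ℂ} (c : ℂ) (h0 : 0 ≤ z.re)
    (h1 : z.re ≤ 1) : ‖analyticPower p z c‖ ≤ Real.exp (p * |Real.log ‖c‖|) := by
  by_cases hc : c = 0
  · simp [analyticPower, hc]
  · rcases hp.eq_or_lt with rfl | hp
    · simp [analyticPower, hc]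
    have hc' : 0 < ‖c‖ := norm_pos_iff.2 hc
    rw [norm_analyticPower (by nlinarith [mul_pos hp (show 0 < 1 - z.re / 2 by linarith)]),
      Real.rpow_def_of_pos hc', Real.exp_le_exp]
    have h2 := le_abs_self (Real.log ‖c‖)
    have h3 := abs_nonneg (Real.log ‖c‖)
    calc Real.log ‖c‖ * (p * (1 - z.re / 2)) ≤ |Real.log ‖c‖| * (p * (1 - z.re / 2)) := by
          gcongr
          exact mul_nonneg hp.le (by linarith)
      _ ≤ |Real.log ‖c‖| * (p * 1) := by gcongr; linarith
      _ = _ := by ring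

/-- The point `θ = 2 - 2/p` solves `1/p = (1 - θ)/1 + θ/2`, so the exponent `p(1 - θ/2)` is `1`
there. -/
theorem analyticPower_interpolation_point {p : ℝ} (hp : p ≠ 0) (c : ℂ) :
    analyticPower p ((2 - 2 / p : ℝ) : ℂ) c = c := by
  by_cases hc : c = 0
  · simp [analyticPower, hc]
  · have hc' : 0 < ‖c‖ := norm_pos_iff.2 hc
    rw [analyticPower, if_neg hc]
    have : (p * (1 - ((2 - 2 / p : ℝ) : ℂ) / 2) * Real.log ‖c‖ : ℂ) = (Real.log ‖c‖ : ℝ) := by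
      have : (p : ℂ) ≠ 0 := by exact_mod_cast hp
      push_cast
      field_simp
      ring
    rw [this, ← Complex.ofReal_exp, Real.exp_log hc', div_mul_cancel₀]
    exact_mod_cast hc'.ne'

theorem differentiable_analyticPower (p : ℝ) (c : ℂ) :
    Differentiable ℂ fun z => analyticPower p z c := by
  unfold analyticPower
  split_ifs <;> fun_prop

section Interpolation

variable {α β : Type*} [MeasurableSpace α] [MeasurableSpace β] {μ : Measure α} {ν : Measure β}

theorem MeasureTheory.SimpleFunc.integrable_map_of_map_zero {g : SimpleFunc α ℂ} (hg : Integrable g μ) {w : ℂ → ℂ}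
    (hw : w 0 = 0) : Integrable (g.map w) μ :=
  SimpleFunc.integrable_iff_finMeasSupp.2 ((SimpleFunc.integrable_iff_finMeasSupp.1 hg).map hw)

theorem MeasureTheory.SimpleFunc.integrable_norm_rpow {g : SimpleFunc α ℂ} (hg : Integrable g μ) {p : ℝ}
    (hp : p ≠ 0) : Integrable (fun x => ‖g x‖ ^ p) μ := by
  have := (MeasureTheory.SimpleFunc.integrable_map_of_map_zero hg (w := fun c => ((‖c‖ ^ p : ℝ) : ℂ))
    (by simp [Real.zero_rpow hp])).norm
  refine this.congr (Filter.Eventually.of_forall fun x => ?_)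
  simp [abs_of_nonneg (Real.rpow_nonneg (norm_nonneg (g x)) p)]

theorem MeasureTheory.SimpleFunc.comp_eq_sum (g : SimpleFunc α ℂ) (w : ℂ → ℂ) (x : α) :
    w (g x) = ∑ c ∈ g.range, w c * (g ⁻¹' {c}).indicator 1 x := by
  rw [Finset.sum_eq_single (g x)]
  · simp
  · intro c _ hc
    simp [hc.symm]
  · intro h
    exact absurd (SimpleFunc.mem_range_self g x) h

/-- With `w = analyticPower p z`, this displays the form as a finite combination of entire functions
of `z` with constant coefficients. Holomorphy and boundedness on the strip follow without
differentiating under the integral. -/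
theorem integral_mul_simpleFunc_eq_sum {k : α × β → ℂ} (hk : AEStronglyMeasurable k (μ.prod ν))
    {A : ℝ} (hA : ∀ x, ‖k x‖ ≤ A) {g : SimpleFunc α ℂ} {h : SimpleFunc β ℂ}
    (hg : Integrable g μ) (hh : Integrable h ν) {w : ℂ → ℂ} (hw : w 0 = 0) :
    ∫ x, k x * (w (g x.1) * w (h x.2)) ∂μ.prod ν = ∑ c ∈ g.range, ∑ d ∈ h.range, w c * w d *
      ∫ x, k x * ((g ⁻¹' {c}).indicator 1 x.1 * (h ⁻¹' {d}).indicator 1 x.2) ∂μ.prod ν := by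
  have hint : ∀ c d, Integrable (fun x : α × β => w c * w d * (k x *
      ((g ⁻¹' {c}).indicator 1 x.1 * (h ⁻¹' {d}).indicator 1 x.2))) (μ.prod ν) := by
    intro c d
    -- The fibre over `0` may have infinite measure; `w 0 = 0` removes it.
    by_cases hc : c = 0
    · simp [hc, hw]
    by_cases hd : d = 0
    · simp [hd, hw]
    refine Integrable.const_mul (Integrable.bdd_mul ?_ hk (Filter.Eventually.of_forall hA)) _
    refine Integrable.mul_prod (f := (g ⁻¹' {c}).indicator (1 : α → ℂ))
      (g := (h ⁻¹' {d}).indicator (1 : β → ℂ)) ?_ ?_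
    · exact (integrable_indicator_iff (g.measurableSet_fiber c)).2
        (integrableOn_const ((SimpleFunc.measure_preimage_lt_top_of_integrable g hg hc).ne))
    · exact (integrable_indicator_iff (h.measurableSet_fiber d)).2
        (integrableOn_const ((SimpleFunc.measure_preimage_lt_top_of_integrable h hh hd).ne))
  simp_rw [← integral_const_mul]
  have hsum : ∀ c ∈ g.range, ∑ d ∈ h.range, ∫ x, w c * w d * (k x *
      ((g ⁻¹' {c}).indicator 1 x.1 * (h ⁻¹' {d}).indicator 1 x.2)) ∂μ.prod ν =
      ∫ x, ∑ d ∈ h.range, w c * w d * (k x *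
      ((g ⁻¹' {c}).indicator 1 x.1 * (h ⁻¹' {d}).indicator 1 x.2)) ∂μ.prod ν :=
    fun c _ => (integral_finsetSum _ fun d _ => hint c d).symm
  rw [Finset.sum_congr rfl hsum,
    ← integral_finsetSum _ fun c _ => integrable_finsetSum _ fun d _ => hint c d]
  refine integral_congr_ae (Filter.Eventually.of_forall fun x => ?_)
  dsimp only
  rw [g.comp_eq_sum w x.1, h.comp_eq_sum w x.2, Finset.sum_mul_sum, Finset.mul_sum]
  refine Finset.sum_congr rfl fun c _ => ?_
  rw [Finset.mul_sum]
  exact Finset.sum_congr rfl fun d _ => by ring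

variable [SFinite μ] [SFinite ν]

open Complex.HadamardThreeLines in
/-- Riesz–Thorin interpolation between `L¹ → L^∞` and `L² → L²`, for the bilinear form with a
bounded kernel on simple functions. -/
theorem norm_integral_mul_simpleFunc_le {k : α × β → ℂ}
    (hk : AEStronglyMeasurable k (μ.prod ν)) {A D : ℝ} (hA : ∀ x, ‖k x‖ ≤ A)
    (hA0 : 0 ≤ A) (hD0 : 0 ≤ D)
    (hD : ∀ (g : SimpleFunc α ℂ) (h : SimpleFunc β ℂ), Integrable g μ → Integrable h ν →
      ‖∫ x, k x * (g x.1 * h x.2) ∂μ.prod ν‖ ≤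
        D * ((∫ x, ‖g x‖ ^ (2 : ℝ) ∂μ) ^ (1 / 2 : ℝ) * (∫ x, ‖h x‖ ^ (2 : ℝ) ∂ν) ^ (1 / 2 : ℝ)))
    {p : ℝ} (hp1 : 1 ≤ p) (hp2 : p ≤ 2) (g : SimpleFunc α ℂ) (h : SimpleFunc β ℂ)
    (hg : Integrable g μ) (hh : Integrable h ν) :
    ‖∫ x, k x * (g x.1 * h x.2) ∂μ.prod ν‖ ≤ A ^ ((2 - p) / p) * D ^ (2 - 2 / p) *
        ((∫ x, ‖g x‖ ^ p ∂μ) ^ (1 / p) * (∫ x, ‖h x‖ ^ p ∂ν) ^ (1 / p)) := by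
  have hp0 : 0 < p := by linarith
  set N := ∫ x, ‖g x‖ ^ p ∂μ
  set N' := ∫ x, ‖h x‖ ^ p ∂ν
  have hN : 0 ≤ N := integral_nonneg fun x => Real.rpow_nonneg (norm_nonneg _) _
  have hN' : 0 ≤ N' := integral_nonneg fun x => Real.rpow_nonneg (norm_nonneg _) _
  set Φ : ℂ → ℂ := fun z =>
    ∫ x, k x * (analyticPower p z (g x.1) * analyticPower p z (h x.2)) ∂μ.prod ν with hΦ
  have hΦs := fun z => integral_mul_simpleFunc_eq_sum hk hA hg hh (analyticPower_zero p z)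
  have hdiff : Differentiable ℂ Φ := by
    have : Φ = _ := funext hΦs
    rw [this]
    refine Differentiable.fun_sum fun c _ => Differentiable.fun_sum fun d _ => ?_
    exact (((differentiable_analyticPower p c).mul (differentiable_analyticPower p d))).mul_const _
  have hbdd : BddAbove ((norm ∘ Φ) '' verticalClosedStrip 0 1) := by
    refine ⟨∑ c ∈ g.range, ∑ d ∈ h.range, Real.exp (p * |Real.log ‖c‖|) *
      Real.exp (p * |Real.log ‖d‖|) * ‖∫ x, k x * ((g ⁻¹' {c}).indicator 1 x.1 *
        (h ⁻¹' {d}).indicator 1 x.2) ∂μ.prod ν‖, ?_⟩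
    rintro _ ⟨z, ⟨h0, h1⟩, rfl⟩
    simp only [Function.comp, hΦ, hΦs]
    refine (norm_sum_le _ _).trans (Finset.sum_le_sum fun c _ => (norm_sum_le _ _).trans
      (Finset.sum_le_sum fun d _ => ?_))
    rw [norm_mul, norm_mul]
    gcongr
    · exact norm_analyticPower_le hp0.le c h0 h1
    · exact norm_analyticPower_le hp0.le d h0 h1
  have h0 : ∀ z ∈ Complex.re ⁻¹' {0}, ‖Φ z‖ ≤ A * (N * N') := by
    intro z hz
    have hz : z.re = 0 := hz
    have hn : ∀ c, ‖analyticPower p z c‖ = ‖c‖ ^ p := fun c => by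
      rw [norm_analyticPower] <;> simp [hz, hp0.ne']
    calc ‖Φ z‖ ≤ ∫ x, A * (‖g x.1‖ ^ p * ‖h x.2‖ ^ p) ∂μ.prod ν := by
          refine norm_integral_le_of_norm_le ?_ (Filter.Eventually.of_forall fun x => ?_)
          · exact ((SimpleFunc.integrable_norm_rpow hg hp0.ne').mul_prod
              (SimpleFunc.integrable_norm_rpow hh hp0.ne')).const_mul A
          · rw [norm_mul, norm_mul, hn, hn]
            gcongr
            exact hA x
      _ = A * (N * N') := by
          rw [integral_const_mul, integral_prod_mul (fun x => ‖g x‖ ^ p) (fun x => ‖h x‖ ^ p)]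
  have h1 : ∀ z ∈ Complex.re ⁻¹' {1}, ‖Φ z‖ ≤ D * (N * N') ^ (1 / 2 : ℝ) := by
    intro z hz
    have hz : z.re = 1 := hz
    have hn : ∀ c, ‖analyticPower p z c‖ ^ (2 : ℝ) = ‖c‖ ^ p := fun c => by
      rw [norm_analyticPower (by rw [hz]; norm_num; exact hp0.ne'), hz,
        ← Real.rpow_mul (norm_nonneg c)]
      congr 1
      ring
    have := hD _ _ (SimpleFunc.integrable_map_of_map_zero hg (analyticPower_zero p z))
      (SimpleFunc.integrable_map_of_map_zero hh (analyticPower_zero p z))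
    simp only [SimpleFunc.map_apply, hn] at this
    rwa [Real.mul_rpow hN hN']
  have hθ : (1 : ℝ) ≤ 2 / p := (one_le_div hp0).2 hp2
  have hθ' : 2 / p ≤ (2 : ℝ) := div_le_self zero_le_two hp1
  have key := norm_le_interp_of_mem_verticalClosedStrip₀₁' Φ (z := ((2 - 2 / p : ℝ) : ℂ))
    (a := A * (N * N')) (b := D * (N * N') ^ (1 / 2 : ℝ))
    ⟨by rw [Complex.ofReal_re]; linarith, by rw [Complex.ofReal_re]; linarith⟩
    hdiff.diffContOnCl hbdd h0 h1
  simp only [hΦ, analyticPower_interpolation_point hp0.ne', Complex.ofReal_re] at key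
  refine key.trans_eq ?_
  have hNN : 0 ≤ N * N' := mul_nonneg hN hN'
  rw [Real.mul_rpow hA0 hNN, Real.mul_rpow hD0 (Real.rpow_nonneg hNN _), ← Real.rpow_mul hNN,
    ← Real.mul_rpow hN hN', show (1 : ℝ) - (2 - 2 / p) = (2 - p) / p by field_simp; ring]
  rcases hNN.eq_or_lt with hz | hpos
  · rw [← hz, Real.zero_rpow (show 1 / p ≠ 0 by positivity)]
    -- At `p = 2` the first factor is `0 ^ 0 = 1`, and the second one vanishes instead.
    rcases eq_or_ne p 2 with rfl | hp
    · norm_num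
    · rw [Real.zero_rpow (div_ne_zero (sub_ne_zero.2 hp.symm) hp0.ne')]
      ring
  · have : (N * N') ^ (1 / p) = (N * N') ^ ((2 - p) / p) * (N * N') ^ (1 / 2 * (2 - 2 / p)) := by
      rw [← Real.rpow_add hpos]
      congr 1
      field_simp
      ring
    rw [this]
    ring

end Interpolation

/-! ### Duality for `L^q` norms. -/

section Duality

variable {α : Type*} [MeasurableSpace α] {μ : Measure α}

theorem enorm_integral_mul_le_eLpNorm_mul_eLpNorm {p q : ℝ≥0∞} [ENNReal.HolderConjugate p q]
    {f g : α → ℂ} (hf : AEStronglyMeasurable f μ) (hg : AEStronglyMeasurable g μ) :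
    ‖∫ x, f x * g x ∂μ‖ₑ ≤ eLpNorm f p μ * eLpNorm g q μ := by
  refine (enorm_integral_le_lintegral_enorm _).trans ?_
  rw [← eLpNorm_one_eq_lintegral_enorm]
  have h := eLpNorm_smul_le_mul_eLpNorm (𝕜 := ℂ) (E := ℂ) (p := p) (q := q) (r := 1) hg hf
  exact h

/-- In `|f| = |f|^{1-2/q} |f|^{2/q}` the first factor is bounded and the second lies in `L^q`. This
supplies the finiteness of the `L^q` norm that the duality argument needs. -/
theorem MeasureTheory.MemLp.of_two_of_bound {f : α → ℂ} (hf : MemLp f 2 μ) {A : ℝ}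
    (hA : ∀ x, ‖f x‖ ≤ A) {q : ℝ} (hq : 2 ≤ q) : MemLp f (ENNReal.ofReal q) μ := by
  have hq0 : 0 < q := by linarith
  have h := hf.norm_rpow_div (ENNReal.ofReal (2 / q))
  rw [ENNReal.toReal_ofReal (by positivity)] at h
  have h2 : (2 : ℝ≥0∞) / ENNReal.ofReal (2 / q) = ENNReal.ofReal q := by
    rw [← ENNReal.ofReal_ofNat, ← ENNReal.ofReal_div_of_pos (by positivity)]
    congr 1
    field_simp
  rw [h2] at h
  refine h.of_le_mul hf.1 (c := A ^ (1 - 2 / q)) (Filter.Eventually.of_forall fun x => ?_)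
  have h3 : 2 / q ≤ 1 := (div_le_one hq0).2 hq
  have h4 : ‖f x‖ = ‖f x‖ ^ (1 - 2 / q) * ‖f x‖ ^ (2 / q) := by
    rw [← Real.rpow_add_of_nonneg (norm_nonneg _) (by linarith) (by positivity)]
    simp
  rw [Real.norm_eq_abs, abs_of_nonneg (by positivity)]
  nth_rewrite 1 [h4]
  gcongr
  exact hA x

/-- The `L^q` norm is controlled by testing against integrable simple functions. -/
theorem eLpNorm_le_of_forall_simpleFunc {p q : ℝ} (hpq : p.HolderConjugate q) {f : α → ℂ}
    (hf : MemLp f (ENNReal.ofReal q) μ) {M : ℝ≥0∞}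
    (hM : ∀ h : SimpleFunc α ℂ, Integrable h μ →
      ‖∫ x, f x * h x ∂μ‖ₑ ≤ M * eLpNorm h (ENNReal.ofReal p) μ) :
    eLpNorm f (ENNReal.ofReal q) μ ≤ M := by
  rcases eq_or_ne M ⊤ with rfl | hMtop
  · exact le_top
  have := hpq.ennrealOfReal
  have := hpq.symm.ennrealOfReal
  have hp0 := hpq.pos
  have hq0 := hpq.symm.pos
  have hq1 : 0 < q - 1 := by linarith [hpq.symm.lt]
  set X := eLpNorm f (ENNReal.ofReal q) μ with hX
  have hXtop : X ≠ ⊤ := hf.2.ne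
  -- The extremal function for Hölder: `f u = |f|^q` and `|u| = |f|^{q-1}`.
  set u : α → ℂ := fun x => (starRingEnd ℂ) (f x) * ((‖f x‖ ^ (q - 2) : ℝ) : ℂ) with hu
  have hnu : ∀ x, ‖u x‖ = ‖f x‖ ^ (q - 1) := by
    intro x
    by_cases h0 : f x = 0
    · simp [hu, h0, Real.zero_rpow hq1.ne']
    · have h1 : 0 < ‖f x‖ := norm_pos_iff.2 h0
      rw [hu, norm_mul, RCLike.norm_conj, Complex.norm_real, Real.norm_eq_abs,
        abs_of_nonneg (by positivity)]
      conv_lhs => rw [← Real.rpow_one ‖f x‖]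
      rw [← Real.rpow_mul h1.le, one_mul, ← Real.rpow_add h1]
      ring_nf
  have hum : AEStronglyMeasurable u μ := by
    refine (Complex.continuous_conj.comp_aestronglyMeasurable hf.1).mul ?_
    refine Complex.continuous_ofReal.comp_aestronglyMeasurable ?_
    exact (hf.1.norm.aemeasurable.pow_const _).aestronglyMeasurable
  have hup : eLpNorm u (ENNReal.ofReal p) μ = X ^ (q - 1) := by
    rw [← eLpNorm_norm u]
    simp_rw [hnu]
    rw [eLpNorm_norm_rpow f hq1, ← ENNReal.ofReal_mul hp0.le, mul_comm, hpq.symm.sub_one_mul_conj]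
  have huL : MemLp u (ENNReal.ofReal p) μ :=
    ⟨hum, by rw [hup]; exact ENNReal.rpow_lt_top_of_nonneg hq1.le hXtop⟩
  have hfu : ‖∫ x, f x * u x ∂μ‖ₑ = X ^ q := by
    have h1 : ∀ x, f x * u x = ((‖f x‖ ^ q : ℝ) : ℂ) := by
      intro x
      by_cases h0 : f x = 0
      · simp [h0, Real.zero_rpow hq0.ne']
      · have h1 : 0 < ‖f x‖ := norm_pos_iff.2 h0
        rw [hu, ← mul_assoc, Complex.mul_conj, Complex.normSq_eq_norm_sq, ← Complex.ofReal_mul,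
          ← Real.rpow_natCast, ← Real.rpow_add h1]
        norm_num
    simp_rw [h1]
    rw [integral_complex_ofReal, ← ofReal_norm, Complex.norm_real, Real.norm_eq_abs,
      abs_of_nonneg (integral_nonneg fun x => by positivity), hX,
      hf.eLpNorm_eq_integral_rpow_norm (by simpa using hq0) ENNReal.ofReal_ne_top,
      ENNReal.toReal_ofReal hq0.le, ENNReal.ofReal_rpow_of_nonneg (by positivity) hq0.le,
      Real.rpow_inv_rpow (integral_nonneg fun x => by positivity) hq0.ne']
  have key : X ^ q ≤ M * X ^ (q - 1) := by
    -- `u` need not be simple; replacing it by a simple function `ε`-close in `L^p` costs at most `X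
    -- * ε` by Hölder.
    have hε : ∀ ε : ℝ≥0∞, ε ≠ 0 → X ^ q ≤ M * (X ^ (q - 1) + ε) + X * ε := by
      intro ε hε
      obtain ⟨h, hh, hhL⟩ := huL.exists_simpleFunc_eLpNorm_sub_lt ENNReal.ofReal_ne_top hε
      have hhi : Integrable h μ :=
        (SimpleFunc.memLp_iff_integrable (by simpa using hp0) ENNReal.ofReal_ne_top).1 hhL
      have hsplit : ∫ x, f x * u x ∂μ = ∫ x, f x * h x ∂μ + ∫ x, f x * (u - h) x ∂μ := by
        rw [← integral_add (f := fun x => f x * h x) (g := fun x => f x * (u - h) x)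
          (hf.integrable_mul hhL) (hf.integrable_mul (huL.sub hhL))]
        congr 1 with x
        simp only [Pi.sub_apply]
        ring
      have hle : eLpNorm h (ENNReal.ofReal p) μ ≤ X ^ (q - 1) + ε := by
        have : (h : α → ℂ) = u - (u - h) := by simp
        rw [this]
        refine (eLpNorm_sub_le hum (hum.sub hhL.1) ?_).trans ?_
        · rw [← ENNReal.ofReal_one]
          exact ENNReal.ofReal_le_ofReal hpq.lt.le
        · rw [hup]
          gcongr
      rw [← hfu, hsplit]
      refine (enorm_add_le _ _).trans (add_le_add ((hM h hhi).trans (by gcongr)) ?_)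
      exact (enorm_integral_mul_le_eLpNorm_mul_eLpNorm hf.1 (hum.sub hhL.1)).trans (by gcongr)
    have hlim : Filter.Tendsto (fun ε : ℝ≥0∞ => M * (X ^ (q - 1) + ε) + X * ε)
        (nhdsWithin 0 {0}ᶜ) (nhds (M * (X ^ (q - 1) + 0) + X * 0)) := by
      refine Filter.Tendsto.mono_left ?_ nhdsWithin_le_nhds
      refine Filter.Tendsto.add ?_ ?_
      · exact ENNReal.Tendsto.const_mul (tendsto_const_nhds.add Filter.tendsto_id) (Or.inr hMtop)
      · exact ENNReal.Tendsto.const_mul Filter.tendsto_id (Or.inr hXtop)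
    have : (nhdsWithin (0 : ℝ≥0∞) {0}ᶜ).NeBot := inferInstance
    simpa using ge_of_tendsto hlim (by
      filter_upwards [self_mem_nhdsWithin] with ε hε' using hε ε hε')
  rcases eq_or_ne X 0 with h0 | h0
  · simp [h0]
  · have h1 : X ^ q = X * X ^ (q - 1) := by
      conv_rhs => rw [← ENNReal.rpow_one X]
      rw [← ENNReal.rpow_mul, one_mul, ← ENNReal.rpow_add _ _ h0 hXtop]
      ring_nf
    rw [h1] at key
    -- Cancelling `X ^ (q - 1)` requires it to be finite, hence the a priori assumption `f ∈ L^q`.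
    exact (ENNReal.mul_le_mul_iff_left (by simp [h0, hXtop])
      (ENNReal.rpow_ne_top_of_nonneg hq1.le hXtop)).1 key

end Duality

/-! ### Convolution with a Schwartz kernel: the `L^p → L^{p'}` bound. -/

section Convolution

variable {E : Type*} [NormedAddCommGroup E] [InnerProductSpace ℝ E] [FiniteDimensional ℝ E]
  [MeasurableSpace E] [BorelSpace E]

/-- The convolution of a function with a Schwartz kernel. -/
noncomputable def schwartzConv (K : 𝓢(E, ℂ)) (g : E → ℂ) (x : E) : ℂ := ∫ y, K (x - y) * g y

variable {K : 𝓢(E, ℂ)} {g : E → ℂ}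

theorem eLpNorm_schwartz_sub_left (K : 𝓢(E, ℂ)) (q : ℝ≥0∞) (x : E) :
    eLpNorm (fun y => K (x - y)) q volume = eLpNorm K q volume :=
  eLpNorm_comp_measurePreserving K.continuous.aestronglyMeasurable
    (Measure.measurePreserving_sub_left volume x)

theorem memLp_schwartz_sub_left (K : 𝓢(E, ℂ)) (q : ℝ≥0∞) (x : E) :
    MemLp (fun y => K (x - y)) q volume :=
  ⟨(K.continuous.comp (by fun_prop)).aestronglyMeasurable,
    by rw [eLpNorm_schwartz_sub_left]; exact (K.memLp q volume).2⟩

theorem integrable_schwartzConv_integrand {p : ℝ≥0∞} (hp : 1 ≤ p) (hg : MemLp g p volume) (x : E) :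
    Integrable (fun y => K (x - y) * g y) volume := by
  have := ENNReal.HolderConjugate.conjExponent hp
  exact (hg.integrable_mul (memLp_schwartz_sub_left K p.conjExponent x)).congr
    (Filter.Eventually.of_forall fun y => mul_comm _ _)

theorem enorm_schwartzConv_le {p q : ℝ≥0∞} [ENNReal.HolderConjugate p q]
    (hg : AEStronglyMeasurable g volume) (x : E) :
    ‖schwartzConv K g x‖ₑ ≤ eLpNorm K p volume * eLpNorm g q volume := by
  rw [← eLpNorm_schwartz_sub_left K p x]
  exact enorm_integral_mul_le_eLpNorm_mul_eLpNorm (memLp_schwartz_sub_left K p x).1 hg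

theorem aestronglyMeasurable_schwartzConv (hg : AEStronglyMeasurable g volume) :
    AEStronglyMeasurable (schwartzConv K g) volume := by
  refine AEStronglyMeasurable.integral_prod_right' (f := fun z : E × E => K (z.1 - z.2) * g z.2) ?_
  exact (K.continuous.comp (by fun_prop)).aestronglyMeasurable.mul hg.comp_snd

theorem schwartzConv_sub {p : ℝ≥0∞} (hp : 1 ≤ p) {g' : E → ℂ} (hg : MemLp g p volume)
    (hg' : MemLp g' p volume) (x : E) :
    schwartzConv K (g - g') x = schwartzConv K g x - schwartzConv K g' x := by
  rw [schwartzConv, schwartzConv, schwartzConv,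
    ← integral_sub (integrable_schwartzConv_integrand hp hg x)
    (integrable_schwartzConv_integrand hp hg' x)]
  congr 1 with y
  simp only [Pi.sub_apply]
  ring

/-- A bound for the convolution operator that holds on arbitrarily good approximations of `g` also
holds for `g`. -/
theorem eLpNorm_schwartzConv_le_of_approx {p r C : ℝ≥0∞} (hp : 1 ≤ p) (hC : C ≠ ⊤)
    (hg : MemLp g p volume)
    (h : ∀ ε : ℝ≥0∞, ε ≠ 0 → ∃ g' : E → ℂ, MemLp g' p volume ∧ eLpNorm (g - g') p volume ≤ ε ∧
      eLpNorm (schwartzConv K g') r volume ≤ C * eLpNorm g' p volume) :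
    eLpNorm (schwartzConv K g) r volume ≤ C * eLpNorm g p volume := by
  have hε : ∀ n : ℕ, ((n : ℝ≥0∞) + 1)⁻¹ ≠ 0 := fun n => by simp
  choose! G hGp hGε hGr using h
  set F : ℕ → E → ℂ := fun n => G ((n : ℝ≥0∞) + 1)⁻¹
  have hεlim : Filter.Tendsto (fun n : ℕ => ((n : ℝ≥0∞) + 1)⁻¹) Filter.atTop (nhds 0) := by
    have := (Filter.tendsto_add_atTop_iff_nat 1).2 ENNReal.tendsto_inv_nat_nhds_zero
    simpa using this
  -- Since `K` lies in the dual Lebesgue space, `L^p` convergence of the approximations gives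
  -- pointwise convergence of the convolutions; Fatou's lemma then passes to the limit.
  have hconv : ∀ x, Filter.Tendsto (fun n => schwartzConv K (F n) x) Filter.atTop
      (nhds (schwartzConv K g x)) := by
    intro x
    have := ENNReal.HolderConjugate.conjExponent hp
    have := ENNReal.HolderConjugate.symm (p := p) (q := p.conjExponent)
    rw [tendsto_iff_edist_tendsto_0]
    have hlim : Filter.Tendsto (fun n : ℕ => eLpNorm K p.conjExponent volume *
        ((n : ℝ≥0∞) + 1)⁻¹) Filter.atTop (nhds 0) := by
      simpa using ENNReal.Tendsto.const_mul hεlim (Or.inr (K.memLp p.conjExponent volume).2.ne)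
    refine tendsto_of_tendsto_of_tendsto_of_le_of_le tendsto_const_nhds hlim (fun _ => zero_le)
      fun n => ?_
    dsimp only
    rw [edist_comm, edist_eq_enorm_sub, ← schwartzConv_sub hp hg (hGp _ (hε n))]
    refine (enorm_schwartzConv_le (p := p.conjExponent) (q := p)
      (hg.sub (hGp _ (hε n))).1 x).trans ?_
    gcongr
    exact hGε _ (hε n)
  refine (Lp.eLpNorm_lim_le_liminf_eLpNorm
    (fun n => aestronglyMeasurable_schwartzConv (hGp _ (hε n)).1) _
    (Filter.Eventually.of_forall hconv)).trans ?_
  have hlim : Filter.Tendsto (fun n : ℕ => C * (eLpNorm g p volume + ((n : ℝ≥0∞) + 1)⁻¹))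
      Filter.atTop (nhds (C * eLpNorm g p volume)) := by
    simpa using ENNReal.Tendsto.const_mul (tendsto_const_nhds.add hεlim) (Or.inr hC)
  rw [← hlim.liminf_eq]
  refine Filter.liminf_le_liminf (Filter.Eventually.of_forall fun n => ?_)
  refine (hGr _ (hε n)).trans ?_
  gcongr
  have : F n = g - (g - F n) := by simp
  change eLpNorm (F n) p volume ≤ _
  rw [this]
  exact (eLpNorm_sub_le hg.1 (hg.sub (hGp _ (hε n))).1 hp).trans (by gcongr; exact hGε _ (hε n))

open FourierTransform in
theorem eLpNorm_two_schwartzConv_schwartz_le {D : ℝ} (hD : ∀ ξ, ‖𝓕 K ξ‖ ≤ D) (u : 𝓢(E, ℂ)) :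
    eLpNorm (schwartzConv K u) 2 volume ≤ ENNReal.ofReal D * eLpNorm u 2 volume := by
  have hnorm : ∀ v : 𝓢(E, ℂ), eLpNorm (𝓕 v : 𝓢(E, ℂ)) 2 volume = eLpNorm v 2 volume := by
    intro v
    have := v.norm_fourier_toL2_eq
    rw [SchwartzMap.norm_toLp, SchwartzMap.norm_toLp] at this
    exact (ENNReal.toReal_eq_toReal_iff' ((𝓕 v : 𝓢(E, ℂ)).memLp 2 volume).2.ne (v.memLp 2 volume).2.ne).1 this
  set w := SchwartzMap.convolution (ContinuousLinearMap.mul ℂ ℂ) u K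
  have hw : schwartzConv K u = w := by
    funext x
    rw [SchwartzMap.convolution_apply, convolution_def]
    simp [schwartzConv, mul_comm]
  rw [hw, ← hnorm w, ← hnorm u]
  refine eLpNorm_le_mul_eLpNorm_of_ae_le_mul (Filter.Eventually.of_forall fun ξ => ?_) 2
  rw [SchwartzMap.fourier_convolution]
  simp only [SchwartzMap.pairing_apply_apply, ContinuousLinearMap.mul_apply', norm_mul]
  rw [mul_comm]
  gcongr
  exact hD ξ

open FourierTransform in
theorem eLpNorm_two_schwartzConv_le {D : ℝ} (hD : ∀ ξ, ‖𝓕 K ξ‖ ≤ D) (hg : MemLp g 2 volume) :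
    eLpNorm (schwartzConv K g) 2 volume ≤ ENNReal.ofReal D * eLpNorm g 2 volume := by
  refine eLpNorm_schwartzConv_le_of_approx (by norm_num) ENNReal.ofReal_ne_top hg fun ε hε => ?_
  obtain ⟨δ, hδ, hδε⟩ := ENNReal.lt_iff_exists_nnreal_btwn.1 (pos_iff_ne_zero.2 hε)
  obtain ⟨u, hu1, hu2, hu3⟩ := hg.exist_eLpNorm_sub_le (by norm_num) (by norm_num)
    (show (0 : ℝ) < δ by exact_mod_cast hδ)
  have := eLpNorm_two_schwartzConv_schwartz_le hD (hu1.toSchwartzMap hu2)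
  refine ⟨hu1.toSchwartzMap hu2, (hu1.toSchwartzMap hu2).memLp 2 volume, hu3.trans ?_, this⟩
  rw [ENNReal.ofReal_coe_nnreal]
  exact hδε.le

theorem enorm_schwartzConv_le_of_bound {A : ℝ} (hA : ∀ x, ‖K x‖ ≤ A)
    (hg : AEStronglyMeasurable g volume) (x : E) :
    ‖schwartzConv K g x‖ₑ ≤ ENNReal.ofReal A * eLpNorm g 1 volume := by
  have := ENNReal.HolderConjugate.top_one
  refine (enorm_schwartzConv_le (p := ⊤) (q := 1) hg x).trans ?_
  gcongr
  exact eLpNormEssSup_le_of_ae_bound (Filter.Eventually.of_forall hA)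

open FourierTransform in
-- Interpolation applied to the kernel `(y, x) ↦ K (x - y)`. The `L²` hypothesis of the
-- interpolation comes from Plancherel and Cauchy–Schwarz.
theorem enorm_integral_schwartzConv_mul_simpleFunc_le {A D : ℝ} (hA : ∀ x, ‖K x‖ ≤ A)
    (hD : ∀ ξ, ‖𝓕 K ξ‖ ≤ D) {p : ℝ} (hp1 : 1 ≤ p) (hp2 : p ≤ 2) (g h : SimpleFunc E ℂ)
    (hg : Integrable g volume) (hh : Integrable h volume) :
    ‖∫ x, schwartzConv K g x * h x‖ₑ ≤ ENNReal.ofReal (A ^ ((2 - p) / p) * D ^ (2 - 2 / p)) *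
      (eLpNorm g (ENNReal.ofReal p) volume * eLpNorm h (ENNReal.ofReal p) volume) := by
  have hA0 : 0 ≤ A := (norm_nonneg _).trans (hA 0)
  have hD0 : 0 ≤ D := (norm_nonneg _).trans (hD 0)
  have hkm : Continuous fun z : E × E => K (z.2 - z.1) := K.continuous.comp (by fun_prop)
  have hform : ∀ g h : SimpleFunc E ℂ, Integrable g volume → Integrable h volume →
      ∫ z : E × E, K (z.2 - z.1) * (g z.1 * h z.2) = ∫ x, schwartzConv K g x * h x := by
    intro g h hg hh
    rw [Measure.volume_eq_prod, integral_prod_symm _ ((hg.mul_prod hh).bdd_mul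
      hkm.aestronglyMeasurable (Filter.Eventually.of_forall fun z => hA _))]
    congr 1 with x
    rw [schwartzConv, ← integral_mul_const]
    congr 1 with y
    ring
  have hnorm : ∀ {r : ℝ} (_ : 1 ≤ r) {g : SimpleFunc E ℂ}, Integrable g volume →
      ENNReal.ofReal ((∫ x, ‖g x‖ ^ r) ^ (1 / r)) = eLpNorm g (ENNReal.ofReal r) volume := by
    intro r hr g hg
    have hr0 : ENNReal.ofReal r ≠ 0 := by simpa using by linarith
    rw [((SimpleFunc.memLp_iff_integrable hr0 ENNReal.ofReal_ne_top).2
      hg).eLpNorm_eq_integral_rpow_norm hr0 ENNReal.ofReal_ne_top,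
      ENNReal.toReal_ofReal (by linarith), one_div]
  have key := norm_integral_mul_simpleFunc_le (μ := (volume : Measure E))
    (ν := (volume : Measure E)) hkm.aestronglyMeasurable (fun z => hA (z.2 - z.1)) hA0 hD0
    (fun g h hg hh => ?_) hp1 hp2 g h hg hh
  · rw [← Measure.volume_eq_prod, hform g h hg hh] at key
    rw [← hnorm hp1 hg, ← hnorm hp1 hh, ← ENNReal.ofReal_mul (by positivity),
      ← ENNReal.ofReal_mul (by positivity), ← ofReal_norm]
    exact ENNReal.ofReal_le_ofReal key
  · rw [← Measure.volume_eq_prod, hform g h hg hh, ← ENNReal.ofReal_le_ofReal_iff (by positivity),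
      ENNReal.ofReal_mul hD0, ENNReal.ofReal_mul (by positivity), hnorm one_le_two hg,
      hnorm one_le_two hh, ofReal_norm, ← mul_assoc, ENNReal.ofReal_ofNat]
    have hg2 := (SimpleFunc.memLp_iff_integrable (p := 2) (by norm_num) (by norm_num)).2 hg
    exact (enorm_integral_mul_le_eLpNorm_mul_eLpNorm (p := 2) (q := 2)
      (aestronglyMeasurable_schwartzConv hg.1) hh.1).trans
      (by gcongr; exact eLpNorm_two_schwartzConv_le hD hg2)

open FourierTransform in
/-- Interpolated `L^p → L^{p'}` bound for convolution with a Schwartz kernel. -/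
theorem eLpNorm_schwartzConv_le {A D : ℝ} (hA : ∀ x, ‖K x‖ ≤ A) (hD : ∀ ξ, ‖𝓕 K ξ‖ ≤ D)
    {p q : ℝ} (hpq : p.HolderConjugate q) (hp2 : p ≤ 2) (hg : MemLp g (ENNReal.ofReal p) volume) :
    eLpNorm (schwartzConv K g) (ENNReal.ofReal q) volume ≤
      ENNReal.ofReal (A ^ ((2 - p) / p) * D ^ (2 - 2 / p)) *
        eLpNorm g (ENNReal.ofReal p) volume := by
  have hp0 : ENNReal.ofReal p ≠ 0 := by simpa using hpq.pos
  refine eLpNorm_schwartzConv_le_of_approx (by simpa using hpq.lt.le) ENNReal.ofReal_ne_top hg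
    fun ε hε => ?_
  obtain ⟨g', hg', hgL⟩ := hg.exists_simpleFunc_eLpNorm_sub_lt ENNReal.ofReal_ne_top hε
  refine ⟨g', hgL, hg'.le, ?_⟩
  have hgi := (SimpleFunc.memLp_iff_integrable hp0 ENNReal.ofReal_ne_top).1 hgL
  have hg2 := (SimpleFunc.memLp_iff_integrable (p := 2) (by norm_num) (by norm_num)).2 hgi
  have hF2 : MemLp (schwartzConv K g') 2 volume :=
    ⟨aestronglyMeasurable_schwartzConv hgi.1, (eLpNorm_two_schwartzConv_le hD hg2).trans_lt
      (ENNReal.mul_lt_top ENNReal.ofReal_lt_top hg2.2)⟩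
  have hq2 : 2 ≤ q := by
    rw [hpq.conjugate_eq, le_div_iff₀ hpq.sub_one_pos]
    linarith
  have hbd : ∀ x, ‖schwartzConv K g' x‖ ≤
      (ENNReal.ofReal A * eLpNorm g' 1 volume).toReal := by
    intro x
    rw [← toReal_enorm]
    exact ENNReal.toReal_mono (ENNReal.mul_ne_top ENNReal.ofReal_ne_top
      (memLp_one_iff_integrable.2 hgi).2.ne) (enorm_schwartzConv_le_of_bound hA hgi.1 x)
  refine eLpNorm_le_of_forall_simpleFunc hpq (hF2.of_two_of_bound hbd hq2) fun h hh => ?_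
  rw [mul_assoc]
  exact enorm_integral_schwartzConv_mul_simpleFunc_le hA hD hpq.lt.le hp2 g' h hgi hh

end Convolution

/-! ### Integration by parts for the correlation phase, uniformly in direction and separation. -/

section PhaseDifference

variable {E : Type*} [NormedAddCommGroup E] [InnerProductSpace ℝ E]

/-- The parameters `(m, e, s)` for which both endpoints `m ± (s / 2) e` lie in the closed annulus
of radii `1 / 2` and `3`. -/
def annulusPairs (E : Type*) [NormedAddCommGroup E] [InnerProductSpace ℝ E] : Set (E × E × ℝ) :=
  {q | (1 / 2 ≤ ‖q.1 + (q.2.2 / 2) • q.2.1‖ ∧ ‖q.1 + (q.2.2 / 2) • q.2.1‖ ≤ 3) ∧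
    (1 / 2 ≤ ‖q.1 - (q.2.2 / 2) • q.2.1‖ ∧ ‖q.1 - (q.2.2 / 2) • q.2.1‖ ≤ 3)}

theorem isClosed_annulusPairs : IsClosed (annulusPairs E) := by
  have h1 : Continuous fun q : E × E × ℝ => ‖q.1 + (q.2.2 / 2) • q.2.1‖ := by fun_prop
  have h2 : Continuous fun q : E × E × ℝ => ‖q.1 - (q.2.2 / 2) • q.2.1‖ := by fun_prop
  exact ((isClosed_le continuous_const h1).inter (isClosed_le h1 continuous_const)).inter
    ((isClosed_le continuous_const h2).inter (isClosed_le h2 continuous_const))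

theorem norm_fst_le_of_mem_annulusPairs {q : E × E × ℝ} (hq : q ∈ annulusPairs E) :
    ‖q.1‖ ≤ 3 := by
  have h : q.1 = (1 / 2 : ℝ) • ((q.1 + (q.2.2 / 2) • q.2.1) + (q.1 - (q.2.2 / 2) • q.2.1)) := by
    module
  rw [h, norm_smul, Real.norm_of_nonneg (by norm_num)]
  have := norm_add_le (q.1 + (q.2.2 / 2) • q.2.1) (q.1 - (q.2.2 / 2) • q.2.1)
  have h1 := hq.1.2
  have h2 := hq.2.2
  linarith

theorem abs_le_of_mem_annulusPairs {q : E × E × ℝ} (hq : q ∈ annulusPairs E) (he : ‖q.2.1‖ = 1) :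
    |q.2.2| ≤ 6 := by
  have h : q.2.2 • q.2.1 = (q.1 + (q.2.2 / 2) • q.2.1) - (q.1 - (q.2.2 / 2) • q.2.1) := by
    module
  have := norm_sub_le (q.1 + (q.2.2 / 2) • q.2.1) (q.1 - (q.2.2 / 2) • q.2.1)
  rw [← h, norm_smul, he, Real.norm_eq_abs] at this
  have h1 := hq.1.2
  have h2 := hq.2.2
  linarith

/-- For a unit vector `e`, the derivative in direction `e` of the phase difference
`‖m + (s / 2) e‖ ^ 4 - ‖m - (s / 2) e‖ ^ 4` is `s` times this function. -/
noncomputable def phaseSlope (q : E × E × ℝ) : ℝ :=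
  4 * ‖q.1‖ ^ 2 + 8 * inner ℝ q.1 q.2.1 ^ 2 + q.2.2 ^ 2

/-- A smooth positive function that agrees with `phaseSlope` where the latter is at least `1`. -/
noncomputable def regularizedSlope (q : E × E × ℝ) : ℝ :=
  phaseSlope q + (1 - Real.smoothTransition (phaseSlope q))

theorem contDiff_phaseSlope : ContDiff ℝ ∞ (phaseSlope : E × E × ℝ → ℝ) := by
  unfold phaseSlope
  have h1 : ContDiff ℝ ∞ fun q : E × E × ℝ => ‖q.1‖ ^ 2 := contDiff_fst.norm_sq ℝ
  have h2 : ContDiff ℝ ∞ fun q : E × E × ℝ => inner ℝ q.1 q.2.1 :=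
    contDiff_fst.inner ℝ (contDiff_fst.comp contDiff_snd)
  have h3 : ContDiff ℝ ∞ fun q : E × E × ℝ => q.2.2 := contDiff_snd.comp contDiff_snd
  exact ((contDiff_const.mul h1).add (contDiff_const.mul (h2.pow 2))).add (h3.pow 2)

theorem contDiff_regularizedSlope : ContDiff ℝ ∞ (regularizedSlope : E × E × ℝ → ℝ) :=
  contDiff_phaseSlope.add (contDiff_const.sub
    ((Real.smoothTransition.contDiff (n := ⊤)).comp contDiff_phaseSlope))

theorem regularizedSlope_ne_zero (q : E × E × ℝ) : regularizedSlope q ≠ 0 := by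
  have h0 : 0 ≤ phaseSlope q := by unfold phaseSlope; positivity
  have h1 := Real.smoothTransition.le_one (phaseSlope q)
  unfold regularizedSlope
  rcases h0.eq_or_lt with h | h
  · rw [← h, Real.smoothTransition.zero]
    norm_num
  · linarith

/-- By the parallelogram law `|m|² + s²/4` is the mean of the squared norms of the endpoints, hence
at least `1/4`, and the slope is at least four times this. So the regularization is inactive on the
annulus pairs. -/
theorem regularizedSlope_eq {q : E × E × ℝ} (hq : q ∈ annulusPairs E) (he : ‖q.2.1‖ = 1) :
    regularizedSlope q = phaseSlope q := by
  have h : 1 ≤ phaseSlope q := by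
    have h1 := parallelogram_law_with_norm ℝ q.1 ((q.2.2 / 2) • q.2.1)
    rw [norm_smul, he, Real.norm_eq_abs, mul_one, sq_abs] at h1
    have h2 := hq.1.1
    have h3 := hq.2.1
    have h4 := sq_nonneg (inner ℝ q.1 q.2.1)
    unfold phaseSlope
    nlinarith
  rw [regularizedSlope, Real.smoothTransition.one_of_one_le h]
  ring

/-- Smooth amplitudes supported in `annulusPairs`. -/
structure IsPairAmplitude (b : E × E × ℝ → ℂ) : Prop where
  smooth : ContDiff ℝ ∞ b
  tsupport_subset : tsupport b ⊆ annulusPairs E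

/-- The amplitude obtained after one integration by parts along `e`. -/
noncomputable def nextAmplitude (b : E × E × ℝ → ℂ) (q : E × E × ℝ) : ℂ :=
  fderiv ℝ (fun q => (regularizedSlope q)⁻¹ • b q) q (q.2.1, 0, 0)

variable {b : E × E × ℝ → ℂ}

theorem IsPairAmplitude.eq_zero (hb : IsPairAmplitude b) {q : E × E × ℝ}
    (hq : q ∉ annulusPairs E) : b q = 0 :=
  image_eq_zero_of_notMem_tsupport fun h => hq (hb.tsupport_subset h)

theorem IsPairAmplitude.div_slope (hb : IsPairAmplitude b) :
    IsPairAmplitude fun q => (regularizedSlope q)⁻¹ • b q where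
  smooth := (contDiff_regularizedSlope.inv regularizedSlope_ne_zero).smul hb.smooth
  tsupport_subset := (tsupport_smul_subset_right _ b).trans hb.tsupport_subset

/-- The class is stable under integration by parts, so the step can be iterated. -/
theorem IsPairAmplitude.nextAmplitude (hb : IsPairAmplitude b) :
    IsPairAmplitude (nextAmplitude b) where
  smooth := (hb.div_slope.smooth.fderiv_right (m := ∞) (by simp)).clm_apply
    ((contDiff_fst.comp contDiff_snd).prodMk contDiff_const)
  tsupport_subset := by
    refine (closure_mono ?_).trans ((tsupport_fderiv_subset ℝ).trans hb.div_slope.tsupport_subset)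
    intro q hq h0
    exact hq (by rw [_root_.nextAmplitude, h0]; rfl)

theorem IsPairAmplitude.hasCompactSupport [FiniteDimensional ℝ E] (hb : IsPairAmplitude b)
    (e : E) (s : ℝ) : HasCompactSupport fun m => b (m, e, s) := by
  refine HasCompactSupport.of_support_subset_isCompact (isCompact_closedBall (0 : E) 3)
    fun m hm => ?_
  rw [mem_closedBall_zero_iff]
  by_contra h
  exact hm (hb.eq_zero fun hq => h (norm_fst_le_of_mem_annulusPairs hq))

/-- Uniformity in `e` and `s` comes from compactness: amplitudes are jointly smooth in `(m, e, s)`,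
and on the annulus pairs with `|e| = 1` these parameters are bounded. -/
theorem IsPairAmplitude.exists_bound [FiniteDimensional ℝ E] (hb : IsPairAmplitude b) :
    ∃ C : ℝ, 0 ≤ C ∧ ∀ m e s, ‖e‖ = 1 → ‖b (m, e, s)‖ ≤ C := by
  obtain ⟨C, hC⟩ := ((isCompact_closedBall (0 : E) 3).prod ((isCompact_sphere (0 : E) 1).prod
    (isCompact_closedBall (0 : ℝ) 6))).exists_bound_of_continuousOn hb.smooth.continuous.continuousOn
  refine ⟨max C 0, le_max_right _ _, fun m e s he => ?_⟩
  by_cases hq : (m, e, s) ∈ annulusPairs E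
  · refine (hC _ ⟨?_, ?_, ?_⟩).trans (le_max_left _ _)
    · exact mem_closedBall_zero_iff.2 (norm_fst_le_of_mem_annulusPairs hq)
    · exact mem_sphere_zero_iff_norm.2 he
    · exact mem_closedBall_zero_iff.2 (abs_le_of_mem_annulusPairs hq he)
  · simp [hb.eq_zero hq]

/-- The difference of the phases `‖·‖ ^ 4` at the two endpoints. -/
noncomputable def phaseDiff (e : E) (s : ℝ) (m : E) : ℝ :=
  ‖m + (s / 2) • e‖ ^ 4 - ‖m - (s / 2) • e‖ ^ 4

/-- A difference of squares of `|m ± (s/2)e|²`, whose difference is `2s⟨m, e⟩` and whose sum is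
`2(|m|² + s²/4)`. -/
theorem phaseDiff_eq {e : E} (he : ‖e‖ = 1) (s : ℝ) (m : E) :
    phaseDiff e s m = 4 * s * (inner ℝ m e * (‖m‖ ^ 2 + s ^ 2 / 4)) := by
  have h1 := norm_add_sq_real m ((s / 2) • e)
  have h2 := norm_sub_sq_real m ((s / 2) • e)
  rw [norm_smul, he, mul_one, Real.norm_eq_abs, sq_abs, inner_smul_right] at h1 h2
  rw [phaseDiff, show ∀ x : ℝ, x ^ 4 = (x ^ 2) ^ 2 by intro x; ring, h1,
    show ∀ x : ℝ, x ^ 4 = (x ^ 2) ^ 2 by intro x; ring, h2]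
  ring

theorem contDiff_phaseDiff {e : E} (he : ‖e‖ = 1) (s : ℝ) : ContDiff ℝ ∞ (phaseDiff e s) := by
  rw [funext (phaseDiff_eq he s)]
  have h1 : ContDiff ℝ ∞ fun m : E => ‖m‖ ^ 2 := contDiff_id.norm_sq ℝ
  have h2 : ContDiff ℝ ∞ fun m : E => inner ℝ m e := contDiff_id.inner ℝ contDiff_const
  exact contDiff_const.mul (h2.mul (h1.add contDiff_const))

theorem fderiv_phaseDiff {e : E} (he : ‖e‖ = 1) (s : ℝ) (m : E) :
    fderiv ℝ (phaseDiff e s) m e = s * phaseSlope (m, e, s) := by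
  rw [funext (phaseDiff_eq he s)]
  have h1 : HasFDerivAt (fun m : E => ‖m‖ ^ 2) (2 • innerSL ℝ m) m :=
    (hasStrictFDerivAt_norm_sq m).hasFDerivAt
  have h2 : HasFDerivAt (fun m : E => inner ℝ m e) (innerSL ℝ e) m := by
    have : (fun m : E => inner ℝ m e) = innerSL ℝ e := by
      funext m
      simp [real_inner_comm]
    rw [this]
    exact (innerSL ℝ e).hasFDerivAt
  have h3 := (h2.mul (h1.add_const (s ^ 2 / 4))).const_mul (4 * s)
  have h4 : fderiv ℝ (fun m : E => 4 * s * (inner ℝ m e * (‖m‖ ^ 2 + s ^ 2 / 4))) m = _ :=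
    h3.fderiv
  rw [h4]
  simp [phaseSlope, he]
  ring

variable [FiniteDimensional ℝ E] [MeasurableSpace E] [BorelSpace E]

/-- The oscillatory integral with phase `T * phaseDiff` and amplitude `b`. -/
noncomputable def pairIntegral (b : E × E × ℝ → ℂ) (T : ℝ) (e : E) (s : ℝ) : ℂ :=
  ∫ m, b (m, e, s) * Complex.exp ((T * phaseDiff e s m : ℝ) * Complex.I)

/-- The exponential is its own `e`-derivative divided by `i T s` times the slope. Moving that
derivative onto `b` over the slope produces the next amplitude. -/
theorem norm_pairIntegral_eq (hb : IsPairAmplitude b) {T : ℝ} (hT : 0 < T) {e : E}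
    (he : ‖e‖ = 1) {s : ℝ} (hs : 0 < s) :
    T * s * ‖pairIntegral b T e s‖ = ‖pairIntegral (nextAmplitude b) T e s‖ := by
  set f : E → ℂ := fun m => (regularizedSlope (m, e, s))⁻¹ • b (m, e, s) with hf
  set g : E → ℂ := fun m => Complex.exp ((T * phaseDiff e s m : ℝ) * Complex.I) with hg
  have hι : ContDiff ℝ ∞ fun m : E => (m, e, s) := contDiff_id.prodMk contDiff_const
  have hfd : ContDiff ℝ ∞ f := hb.div_slope.smooth.comp hι
  have hgd : ContDiff ℝ ∞ g := by
    have h1 : ContDiff ℝ ∞ fun m => T * phaseDiff e s m :=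
      contDiff_const.mul (contDiff_phaseDiff he s)
    exact ((Complex.ofRealCLM.contDiff.comp h1).mul contDiff_const).cexp
  have hfc : HasCompactSupport f := hb.div_slope.hasCompactSupport e s
  have hf' : ∀ m, fderiv ℝ f m e = nextAmplitude b (m, e, s) := by
    intro m
    have h1 : HasFDerivAt (fun m : E => (m, e, s)) (ContinuousLinearMap.inl ℝ E (E × ℝ)) m :=
      hasFDerivAt_prodMk_left m (e, s)
    have h2 := (hb.div_slope.smooth.differentiable (by simp) (m, e, s)).hasFDerivAt.comp m h1
    have h3 : fderiv ℝ f m = _ := h2.fderiv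
    rw [h3, nextAmplitude]
    rfl
  have hg' : ∀ m, fderiv ℝ g m e = (T * s * phaseSlope (m, e, s) : ℝ) * Complex.I * g m := by
    intro m
    have h1 := (((contDiff_phaseDiff he s).differentiable (by simp) m).hasFDerivAt.const_mul T)
    have h2 := ((Complex.ofRealCLM.hasFDerivAt.comp m h1).mul_const Complex.I).cexp
    have h3 : fderiv ℝ g m = _ := h2.fderiv
    rw [h3]
    simp [fderiv_phaseDiff he, hg]
    ring
  have hint : ∀ u v : E → ℂ, Continuous u → Continuous v → HasCompactSupport u →
      Integrable (fun m => u m * v m) volume := fun u v hu hv hc =>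
    (hu.mul hv).integrable_of_hasCompactSupport hc.mul_right
  have hf'c : Continuous fun m => fderiv ℝ f m e :=
    (hfd.continuous_fderiv (by simp)).clm_apply continuous_const
  have hg'c : Continuous fun m => fderiv ℝ g m e :=
    (hgd.continuous_fderiv (by simp)).clm_apply continuous_const
  have ibp := integral_mul_fderiv_eq_neg_fderiv_mul_of_integrable (μ := (volume : Measure E))
    (f := f) (g := g) (v := e)
    (hint _ _ hf'c hgd.continuous (hfc.fderiv_apply ℝ e)) (hint _ _ hfd.continuous hg'c hfc)
    (hint _ _ hfd.continuous hgd.continuous hfc)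
    (fun m _ => hfd.differentiable (by simp) m) (fun m _ => hgd.differentiable (by simp) m)
  have hleft : ∀ m, f m * fderiv ℝ g m e =
      ((T * s : ℝ) * Complex.I) * (b (m, e, s) * g m) := by
    intro m
    simp only [hg', hf]
    -- Regularized and true slope may differ off the annulus pairs, but `b` vanishes there.
    by_cases hq : (m, e, s) ∈ annulusPairs E
    · have h1 := regularizedSlope_ne_zero (m, e, s)
      rw [← regularizedSlope_eq hq he, Complex.real_smul]
      have h2 : ((regularizedSlope (m, e, s) : ℝ) : ℂ) ≠ 0 := by exact_mod_cast h1
      push_cast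
      field_simp
    · simp [hb.eq_zero hq]
  simp_rw [hleft, hf'] at ibp
  rw [integral_const_mul] at ibp
  have := congrArg norm ibp
  rw [norm_neg, norm_mul, norm_mul, Complex.norm_real, Complex.norm_I, mul_one, Real.norm_eq_abs,
    abs_of_pos (mul_pos hT hs)] at this
  exact this

theorem exists_pow_mul_norm_pairIntegral_le (N : ℕ) : ∀ b : E × E × ℝ → ℂ, IsPairAmplitude b →
    ∃ C : ℝ, 0 ≤ C ∧ ∀ (T : ℝ) (e : E) (s : ℝ), 0 < T → ‖e‖ = 1 → 0 < s →
      (T * s) ^ N * ‖pairIntegral b T e s‖ ≤ C := by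
  induction N with
  | zero =>
    intro b hb
    obtain ⟨C, hC0, hC⟩ := hb.exists_bound
    refine ⟨C * volume.real (Metric.closedBall (0 : E) 3), by positivity,
      fun T e s _ he _ => ?_⟩
    rw [pow_zero, one_mul, pairIntegral, ← setIntegral_eq_integral_of_forall_compl_eq_zero
      (s := Metric.closedBall (0 : E) 3)]
    · refine norm_setIntegral_le_of_norm_le_const measure_closedBall_lt_top fun m _ => ?_
      rw [norm_mul, Complex.norm_exp_ofReal_mul_I, mul_one]
      exact hC m e s he
    · intro m hm
      rw [hb.eq_zero fun hq => hm (mem_closedBall_zero_iff.2 (norm_fst_le_of_mem_annulusPairs hq)),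
        zero_mul]
  | succ N ih =>
    intro b hb
    obtain ⟨C, hC0, hC⟩ := ih _ hb.nextAmplitude
    refine ⟨C, hC0, fun T e s hT he hs => ?_⟩
    rw [pow_succ, mul_assoc, norm_pairIntegral_eq hb hT he hs]
    exact hC T e s hT he hs

theorem IsPairAmplitude.exists_norm_pairIntegral_le (hb : IsPairAmplitude b) (N : ℕ) :
    ∃ C : ℝ, 0 ≤ C ∧ ∀ (T : ℝ) (e : E) (s : ℝ), 0 < T → ‖e‖ = 1 → 0 < s →
      ‖pairIntegral b T e s‖ ≤ C * (1 + T * s) ^ (-(N : ℝ)) := by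
  obtain ⟨C₀, hC₀, h₀⟩ := exists_pow_mul_norm_pairIntegral_le 0 b hb
  obtain ⟨C₁, hC₁, h₁⟩ := exists_pow_mul_norm_pairIntegral_le N b hb
  refine ⟨2 ^ (N - 1) * (C₀ + C₁), by positivity, fun T e s hT he hs => ?_⟩
  have hTs : 0 < T * s := mul_pos hT hs
  rw [Real.rpow_neg (by positivity), Real.rpow_natCast, ← div_eq_mul_inv,
    le_div_iff₀ (by positivity)]
  have h2 := add_pow_le zero_le_one hTs.le N
  have h3 := h₀ T e s hT he hs
  have h4 := h₁ T e s hT he hs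
  rw [pow_zero, one_mul] at h3
  calc ‖pairIntegral b T e s‖ * (1 + T * s) ^ N
      ≤ ‖pairIntegral b T e s‖ * (2 ^ (N - 1) * (1 ^ N + (T * s) ^ N)) := by gcongr
    _ = 2 ^ (N - 1) * (‖pairIntegral b T e s‖ + (T * s) ^ N * ‖pairIntegral b T e s‖) := by ring
    _ ≤ _ := by gcongr

end PhaseDifference

/-! ### The dispersive estimate for the quartic phase. -/

section Dispersive

variable {E : Type*} [NormedAddCommGroup E] [InnerProductSpace ℝ E] [FiniteDimensional ℝ E]
  [MeasurableSpace E] [BorelSpace E]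

/-- Write the square as a double integral over `(x, y)` and substitute `x = m + η/2`, `y = m - η/2`,
which has unit Jacobian. -/
theorem norm_integral_sq_le_integral_norm_correlation {F : E → ℂ} (hF : Integrable F volume) :
    ‖∫ x, F x‖ ^ 2 ≤ ∫ η : E, ‖∫ m : E, F (m + (1 / 2 : ℝ) • η) *
      (starRingEnd ℂ) (F (m - (1 / 2 : ℝ) • η))‖ := by
  have hG : Integrable (fun z => (starRingEnd ℂ) (F (-z))) volume :=
    (Complex.conjLIE.integrable_comp_iff).2 hF.comp_neg
  have hprod : Integrable (Function.uncurry fun η x => F x * (starRingEnd ℂ) (F (x - η)))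
      (volume.prod volume : Measure (E × E)) := by
    have := hF.convolution_integrand (ContinuousLinearMap.mul ℝ ℂ) hG
    refine this.congr (Filter.Eventually.of_forall fun z => ?_)
    simp [Function.uncurry]
  have h1 : (∫ x, F x) * (starRingEnd ℂ) (∫ x, F x) =
      ∫ η : E, ∫ m : E, F (m + (1 / 2 : ℝ) • η) * (starRingEnd ℂ) (F (m - (1 / 2 : ℝ) • η)) := by
    rw [← integral_conj, ← integral_mul_const]
    have h2 : ∀ x, F x * ∫ y, (starRingEnd ℂ) (F y) =
        ∫ η, F x * (starRingEnd ℂ) (F (x - η)) := by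
      intro x
      rw [integral_const_mul, integral_sub_left_eq_self (fun y => (starRingEnd ℂ) (F y))]
    simp_rw [h2]
    rw [← integral_integral_swap hprod]
    congr 1 with η
    rw [← integral_add_right_eq_self (fun x => F x * (starRingEnd ℂ) (F (x - η)))
      ((1 / 2 : ℝ) • η)]
    congr 1 with m
    congr 3
    module
  have h2 : ‖(∫ x, F x) * (starRingEnd ℂ) (∫ x, F x)‖ = ‖∫ x, F x‖ ^ 2 := by
    rw [norm_mul, RCLike.norm_conj, sq]
  rw [← h2, h1]
  exact norm_integral_le_integral_norm _

/-- Uniform decay of the Fourier transform of `e^{iT‖w‖⁴} χ(w)`, for an amplitude `χ` supported in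
an annulus. -/
theorem exists_norm_integral_quartic_phase_le [Nontrivial E] {χ : E → ℝ} (hχ : ContDiff ℝ ∞ χ)
    (hχs : ∀ w, χ w ≠ 0 → 1 / 2 ≤ ‖w‖ ∧ ‖w‖ ≤ 3) :
    ∃ C : ℝ, 0 < C ∧ ∀ (T : ℝ) (v : E), 0 < T →
      ‖∫ w, Complex.exp ((inner ℝ v w + T * ‖w‖ ^ 4 : ℝ) * Complex.I) * (χ w : ℂ)‖ ≤
        C * T ^ (-(Module.finrank ℝ E / 2 : ℝ)) := by
  set b : E × E × ℝ → ℂ := fun q =>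
    ((χ (q.1 + (q.2.2 / 2) • q.2.1) * χ (q.1 - (q.2.2 / 2) • q.2.1) : ℝ) : ℂ) with hb_def
  have hb : IsPairAmplitude b := by
    constructor
    · have h1 : ContDiff ℝ ∞ fun q : E × E × ℝ => (q.2.2 / 2) • q.2.1 :=
        ((contDiff_snd.comp contDiff_snd).div_const 2).smul (contDiff_fst.comp contDiff_snd)
      exact Complex.ofRealCLM.contDiff.comp
        ((hχ.comp (contDiff_fst.add h1)).mul (hχ.comp (contDiff_fst.sub h1)))
    · refine closure_minimal (fun q hq => ?_) isClosed_annulusPairs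
      have h1 : χ (q.1 + (q.2.2 / 2) • q.2.1) * χ (q.1 - (q.2.2 / 2) • q.2.1) ≠ 0 :=
        fun h => hq (by simp only [hb_def, h, Complex.ofReal_zero])
      exact ⟨hχs _ (left_ne_zero_of_mul h1), hχs _ (right_ne_zero_of_mul h1)⟩
  set d := Module.finrank ℝ E
  -- Decay of order `d + 1` is integrable in dimension `d`.
  obtain ⟨C, hC0, hC⟩ := hb.exists_norm_pairIntegral_le (d + 1)
  have hJ : Integrable (fun x : E => (1 + ‖x‖) ^ (-((d + 1 : ℕ) : ℝ))) volume :=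
    integrable_one_add_norm (by push_cast; linarith)
  set J := ∫ x : E, (1 + ‖x‖) ^ (-((d + 1 : ℕ) : ℝ))
  have hJ0 : 0 ≤ J := integral_nonneg fun x => by positivity
  refine ⟨Real.sqrt (C * J) + 1, by positivity, fun T v hT => ?_⟩
  set F : E → ℂ := fun w =>
    Complex.exp ((inner ℝ v w + T * ‖w‖ ^ 4 : ℝ) * Complex.I) * (χ w : ℂ) with hF_def
  have hFc : Continuous F := by
    have := hχ.continuous
    fun_prop
  have hFs : HasCompactSupport F := by
    refine HasCompactSupport.of_support_subset_isCompact (isCompact_closedBall (0 : E) 3)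
      fun w hw => mem_closedBall_zero_iff.2 (hχs w fun h => hw ?_).2
    simp [hF_def, h]
  -- Take `e = η/|η|` and `s = |η|`. The linear phase leaves only the factor `e^{i⟨v, η⟩}`, which
  -- makes the bound uniform in `v`.
  have hcorr : ∀ η : E, η ≠ 0 → ‖∫ m : E, F (m + (1 / 2 : ℝ) • η) *
      (starRingEnd ℂ) (F (m - (1 / 2 : ℝ) • η))‖ ≤
        C * (1 + ‖T • η‖) ^ (-((d + 1 : ℕ) : ℝ)) := by
    intro η hη
    have hs : 0 < ‖η‖ := norm_pos_iff.2 hη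
    have he : ‖‖η‖⁻¹ • η‖ = 1 := by rw [norm_smul, norm_inv, norm_norm, inv_mul_cancel₀ hs.ne']
    have hse : (‖η‖ / 2) • (‖η‖⁻¹ • η) = (1 / 2 : ℝ) • η := by
      rw [smul_smul]
      congr 1
      field_simp
    have h1 : ∀ m : E, F (m + (1 / 2 : ℝ) • η) * (starRingEnd ℂ) (F (m - (1 / 2 : ℝ) • η)) =
        Complex.exp ((inner ℝ v η : ℝ) * Complex.I) * (b (m, ‖η‖⁻¹ • η, ‖η‖) *
          Complex.exp ((T * phaseDiff (‖η‖⁻¹ • η) ‖η‖ m : ℝ) * Complex.I)) := by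
      intro m
      simp only [hF_def, hb_def, phaseDiff, hse, map_mul, ← Complex.exp_conj, Complex.conj_ofReal,
        Complex.conj_I, inner_add_right, inner_sub_right, inner_smul_right]
      have h2 : ∀ a b c d : ℂ, Complex.exp a * c * (Complex.exp b * d) =
          Complex.exp (a + b) * (c * d) := by
        intro a b c d
        rw [Complex.exp_add]
        ring
      have h3 : ∀ a b c : ℂ, Complex.exp a * (c * Complex.exp b) = Complex.exp (a + b) * c := by
        intro a b c
        rw [Complex.exp_add]
        ring
      rw [h2, h3]
      push_cast
      congr 2
      ring
    simp_rw [h1]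
    rw [integral_const_mul, norm_mul, Complex.norm_exp_ofReal_mul_I, one_mul, norm_smul,
      Real.norm_of_nonneg hT.le]
    exact hC T _ _ hT he hs
  have hbound : Integrable (fun η : E => C * (1 + ‖T • η‖) ^ (-((d + 1 : ℕ) : ℝ))) volume :=
    ((integrable_comp_smul_iff volume (fun x : E => (1 + ‖x‖) ^ (-((d + 1 : ℕ) : ℝ)))
      hT.ne').2 hJ).const_mul C
  have hsq : ‖∫ w, F w‖ ^ 2 ≤ (Real.sqrt (C * J) * T ^ (-(d / 2 : ℝ))) ^ 2 := by
    calc ‖∫ w, F w‖ ^ 2 ≤ _ :=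
          norm_integral_sq_le_integral_norm_correlation (hFc.integrable_of_hasCompactSupport hFs)
      _ ≤ ∫ η : E, C * (1 + ‖T • η‖) ^ (-((d + 1 : ℕ) : ℝ)) := by
          refine integral_mono_of_nonneg (Filter.Eventually.of_forall fun _ => norm_nonneg _)
            hbound ?_
          filter_upwards [Measure.ae_ne volume (0 : E)] with η hη using hcorr η hη
      _ = C * ((T ^ d)⁻¹ * J) := by
          rw [integral_const_mul, Measure.integral_comp_smul volume
            (fun x : E => (1 + ‖x‖) ^ (-((d + 1 : ℕ) : ℝ))), abs_of_pos (by positivity),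
            smul_eq_mul]
      _ = _ := by
          rw [mul_pow, Real.sq_sqrt (by positivity), ← Real.rpow_natCast (T ^ _), ← Real.rpow_mul
            hT.le, ← Real.rpow_natCast T, ← Real.rpow_neg hT.le]
          rw [show -((d : ℝ) / 2) * ((2 : ℕ) : ℝ) = -(d : ℝ) by push_cast; ring]
          ring
  refine (abs_le_of_sq_le_sq' hsq (by positivity)).2.trans ?_
  gcongr
  linarith

end Dispersive

/-! ### Fourier multipliers as convolutions on `L^p`. -/

section Multiplier

variable {E : Type*} [NormedAddCommGroup E] [InnerProductSpace ℝ E] [FiniteDimensional ℝ E]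
  [MeasurableSpace E] [BorelSpace E]

theorem integrable_prod_schwartz_kernel (K u : 𝓢(E, ℂ)) {p : ℝ≥0∞} (hp : 1 ≤ p) {g : E → ℂ}
    (hg : MemLp g p volume) :
    Integrable (Function.uncurry fun x y => u x * (K (x - y) * g y))
      ((volume : Measure E).prod volume) := by
  have := ENNReal.HolderConjugate.conjExponent hp
  have := ENNReal.HolderConjugate.symm (p := p) (q := p.conjExponent)
  have hm : AEStronglyMeasurable (Function.uncurry fun x y => u x * (K (x - y) * g y))
      ((volume : Measure E).prod volume) :=
    (u.continuous.comp continuous_fst).aestronglyMeasurable.mul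
      ((K.continuous.comp (by fun_prop)).aestronglyMeasurable.mul hg.1.comp_snd)
  refine ⟨hm, ?_⟩
  rw [HasFiniteIntegral, lintegral_prod _ hm.enorm]
  set c := eLpNorm K p.conjExponent volume * eLpNorm g p volume
  have hc : c ≠ ⊤ := ENNReal.mul_ne_top (K.memLp p.conjExponent volume).2.ne hg.2.ne
  calc ∫⁻ x, ∫⁻ y, ‖u x * (K (x - y) * g y)‖ₑ ≤ ∫⁻ x, ‖u x‖ₑ * c := by
        refine lintegral_mono fun x => ?_
        simp_rw [enorm_mul (u x)]
        rw [lintegral_const_mul' _ _ enorm_ne_top]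
        gcongr
        rw [← eLpNorm_one_eq_lintegral_enorm]
        have h := eLpNorm_smul_le_mul_eLpNorm (𝕜 := ℂ) (E := ℂ) (p := p.conjExponent) (q := p)
          (r := 1) hg.1 (memLp_schwartz_sub_left K p.conjExponent x).1
        rw [eLpNorm_schwartz_sub_left] at h
        exact h
    _ = (∫⁻ x, ‖u x‖ₑ) * c := lintegral_mul_const' _ _ hc
    _ < ⊤ := ENNReal.mul_lt_top u.integrable.2 hc.lt_top

open FourierTransform in
-- The translate `K(· - y)` has Fourier transform `e^{-2πi⟨ξ, y⟩} M(ξ)`; the identity `∫ û v = ∫ u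
-- v̂` does the rest.
theorem fourier_smulLeftCLM_fourierInv_apply {M : E → ℂ} (hM : M.HasTemperateGrowth)
    (K u : 𝓢(E, ℂ)) (hK : ∀ ξ, 𝓕 K ξ = M ξ) (y : E) :
    𝓕 (SchwartzMap.smulLeftCLM ℂ M (𝓕⁻ u)) y = ∫ x, u x * K (x - y) := by
  have h1 := SchwartzMap.integral_fourier_mul_eq (SchwartzMap.compSubConstCLM ℂ y K) (𝓕⁻ u)
  rw [FourierTransform.fourier_fourierInv_eq] at h1
  simp only [SchwartzMap.compSubConstCLM_apply] at h1
  simp_rw [mul_comm (u _)]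
  rw [← h1, SchwartzMap.fourier_coe, Real.fourier_eq]
  congr 1 with ξ
  have h2 : 𝓕 (SchwartzMap.compSubConstCLM ℂ y K) ξ = Real.fourierChar (-inner ℝ ξ y) • M ξ := by
    rw [← hK, SchwartzMap.fourier_coe, SchwartzMap.fourier_coe]
    have h3 : (SchwartzMap.compSubConstCLM ℂ y K : E → ℂ) = K ∘ fun v => v + -y := by
      funext x
      simp [sub_eq_add_neg]
    rw [h3]
    refine (congrFun (VectorFourier.fourierIntegral_comp_add_right Real.fourierChar volume
      (innerₗ E) K (-y)) ξ).trans ?_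
    rw [map_neg, LinearMap.neg_apply, innerₗ_apply_apply, real_inner_comm]
    rfl
  rw [h2, SchwartzMap.smulLeftCLM_apply_apply hM, smul_mul_assoc, smul_eq_mul]

open FourierTransform in
/-- A Fourier multiplier whose symbol is the Fourier transform of a Schwartz function `K` acts on
`L^p` functions as the convolution with `K`. -/
theorem fourierMultiplierCLM_apply_eq_integral_schwartzConv {M : E → ℂ}
    (hM : M.HasTemperateGrowth) (K : 𝓢(E, ℂ)) (hK : ∀ ξ, 𝓕 K ξ = M ξ) {p : ℝ≥0∞} (hp : 1 ≤ p)
    {g : E → ℂ} (hg : MemLp g p volume) {f : 𝓢'(E, ℂ)} (hf : ∀ u : 𝓢(E, ℂ), f u = ∫ x, u x • g x)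
    (u : 𝓢(E, ℂ)) :
    TemperedDistribution.fourierMultiplierCLM ℂ M f u = ∫ x, u x • schwartzConv K g x := by
  rw [TemperedDistribution.fourierMultiplierCLM_apply_apply, hf]
  simp_rw [fourier_smulLeftCLM_fourierInv_apply hM K u hK, smul_eq_mul, schwartzConv,
    ← integral_const_mul, ← integral_mul_const]
  rw [integral_integral_swap (integrable_prod_schwartz_kernel K u hp hg)]
  simp_rw [mul_assoc]

end Multiplier

/-! ### The localized kernel and the final estimate. -/

section Conclusion

/-- A smooth cutoff to an annulus that equals `1` on the support of every Littlewood–Paley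
function. -/
theorem exists_annulus_cutoff : ∃ χ : R5 → ℝ, ContDiff ℝ ∞ χ ∧
    (∀ w, χ w ≠ 0 → 1 / 2 ≤ ‖w‖ ∧ ‖w‖ ≤ 3) ∧ (∀ w, |χ w| ≤ 1) ∧
    ∀ w, 3 / 4 < ‖w‖ → ‖w‖ < 8 / 3 → χ w = 1 := by
  let b₁ : ContDiffBump (0 : R5) := ⟨8 / 3, 3, by norm_num, by norm_num⟩
  let b₂ : ContDiffBump (0 : R5) := ⟨1 / 2, 3 / 4, by norm_num, by norm_num⟩
  refine ⟨fun w => b₁ w * (1 - b₂ w), b₁.contDiff.mul (contDiff_const.sub b₂.contDiff),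
    fun w hw => ⟨?_, ?_⟩, fun w => ?_, fun w h1 h2 => ?_⟩
  · by_contra! h
    have : b₂ w = 1 := b₂.one_of_mem_closedBall (mem_closedBall_zero_iff.2 h.le)
    exact hw (by simp [this])
  · by_contra! h
    have : b₁ w = 0 := b₁.zero_of_le_dist (by rw [dist_zero_right]; exact h.le)
    exact hw (by simp [this])
  · have h1 := b₁.nonneg (x := w)
    have h2 := b₁.le_one (x := w)
    have h3 := b₂.nonneg (x := w)
    have h4 := b₂.le_one (x := w)
    rw [abs_of_nonneg (mul_nonneg h1 (by linarith))]
    exact mul_le_one₀ h2 (by linarith) (by linarith)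
  · have h3 : b₁ w = 1 := b₁.one_of_mem_closedBall (mem_closedBall_zero_iff.2 h2.le)
    have h4 : b₂ w = 0 := b₂.zero_of_le_dist (by rw [dist_zero_right]; exact h1.le)
    simp [h3, h4]

/-- The symbol of the biharmonic flow, localized to frequencies of size `2 ^ j`, in Mathlib's
normalization of the Fourier transform. -/
noncomputable def localizedSymbol (χ : R5 → ℝ) (j : ℤ) (t : ℝ) (ξ : R5) : ℂ :=
  biharmonicSymbol t ((2 * Real.pi) • ξ) *
    ((χ (((2 : ℝ) ^ (-j) * (2 * Real.pi)) • ξ) : ℝ) : ℂ)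

theorem contDiff_localizedSymbol {χ : R5 → ℝ} (hχ : ContDiff ℝ ∞ χ) (j : ℤ) (t : ℝ) :
    ContDiff ℝ ∞ (localizedSymbol χ j t) :=
  (hasTemperateGrowth_biharmonicSymbol t).1.mul
    (Complex.ofRealCLM.contDiff.comp (hχ.comp (contDiff_const_smul _)))

theorem hasCompactSupport_localizedSymbol {χ : R5 → ℝ}
    (hχs : ∀ w, χ w ≠ 0 → 1 / 2 ≤ ‖w‖ ∧ ‖w‖ ≤ 3) (j : ℤ) (t : ℝ) :
    HasCompactSupport (localizedSymbol χ j t) := by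
  have h : HasCompactSupport χ :=
    HasCompactSupport.of_support_subset_isCompact (isCompact_closedBall (0 : R5) 3)
      fun w hw => mem_closedBall_zero_iff.2 (hχs w hw).2
  have h2 : HasCompactSupport fun ξ : R5 => χ (((2 : ℝ) ^ (-j) * (2 * Real.pi)) • ξ) :=
    h.comp_smul (by positivity)
  exact (h2.comp_left (g := fun x : ℝ => (x : ℂ)) Complex.ofReal_zero).mul_left

theorem norm_localizedSymbol_le {χ : R5 → ℝ} (hχ1 : ∀ w, |χ w| ≤ 1) (j : ℤ) (t : ℝ) (ξ : R5) :
    ‖localizedSymbol χ j t ξ‖ ≤ 1 := by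
  rw [localizedSymbol, biharmonicSymbol, norm_mul, Complex.norm_exp_ofReal_mul_I, one_mul,
    Complex.norm_real]
  exact hχ1 _

open FourierTransform in
theorem norm_fourierInv_localizedSymbol_le {χ : R5 → ℝ} {C : ℝ}
    (hC : ∀ (T : ℝ) (v : R5), 0 < T →
      ‖∫ w, Complex.exp ((inner ℝ v w + T * ‖w‖ ^ 4 : ℝ) * Complex.I) * (χ w : ℂ)‖ ≤
        C * T ^ (-(Module.finrank ℝ R5 / 2 : ℝ))) (j : ℤ) {t : ℝ} (ht : 0 < t) (z : R5) :
    ‖𝓕⁻ (localizedSymbol χ j t) z‖ ≤ C * (2 : ℝ) ^ (-(5 * (j : ℝ))) * t ^ (-(5 / 2 : ℝ)) := by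
  set a : ℝ := (2 : ℝ) ^ (-j) * (2 * Real.pi) with ha
  have ha0 : 0 < a := by positivity
  set T : ℝ := t * ((2 : ℝ) ^ j) ^ 4 with hT
  have hT0 : 0 < T := by positivity
  have h2j : (2 : ℝ) ^ j * a = 2 * Real.pi := by
    rw [ha, ← mul_assoc, ← zpow_add₀ two_ne_zero]
    simp
  set G : R5 → ℂ := fun w =>
    Complex.exp ((inner ℝ ((2 : ℝ) ^ j • z) w + T * ‖w‖ ^ 4 : ℝ) * Complex.I) * (χ w : ℂ) with hG
  have h1 : 𝓕⁻ (localizedSymbol χ j t) z = ∫ ξ : R5, G (a • ξ) := by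
    rw [Real.fourierInv_eq']
    congr 1 with ξ
    simp only [hG]
    rw [localizedSymbol, biharmonicSymbol, smul_eq_mul, ← mul_assoc, ← Complex.exp_add,
      ← add_mul, ← Complex.ofReal_add, inner_smul_left, inner_smul_right, norm_smul, norm_smul,
      Real.norm_of_nonneg ha0.le, Real.norm_of_nonneg (by positivity : (0 : ℝ) ≤ 2 * Real.pi),
      real_inner_comm]
    congr 4
    rw [hT, ← h2j]
    simp
    ring
  have hd : Module.finrank ℝ R5 = 5 := by simp
  have hC' := hC T ((2 : ℝ) ^ j • z) hT0
  rw [h1, Measure.integral_comp_smul, norm_smul, hd, Real.norm_eq_abs, abs_abs,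
    abs_of_pos (by positivity)]
  rw [hd] at hC'
  -- The Jacobian's extra factor `(2π)^{-5}` is at most `1` and is dropped.
  have ha1 : (a ^ 5)⁻¹ ≤ (2 : ℝ) ^ (5 * (j : ℝ)) := by
    have h3 : (2 : ℝ) ^ (-j) ≤ a := le_mul_of_one_le_right (by positivity)
      (by linarith [Real.pi_gt_three])
    have h4 : (2 : ℝ) ^ (5 * (j : ℝ)) = (((2 : ℝ) ^ (-j)) ^ 5)⁻¹ := by
      rw [mul_comm, Real.rpow_mul zero_le_two, Real.rpow_intCast, zpow_neg, inv_pow, inv_inv]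
      exact Real.rpow_natCast _ 5
    rw [h4]
    gcongr
  have hT1 : T ^ (-((5 : ℕ) / 2 : ℝ)) = t ^ (-(5 / 2 : ℝ)) * (2 : ℝ) ^ (-(10 * (j : ℝ))) := by
    rw [hT, Real.mul_rpow ht.le (by positivity), ← Real.rpow_intCast, ← Real.rpow_natCast,
      ← Real.rpow_mul zero_le_two, ← Real.rpow_mul zero_le_two]
    congr 2
    push_cast
    ring
  calc (a ^ 5)⁻¹ * ‖∫ w, G w‖
      ≤ (2 : ℝ) ^ (5 * (j : ℝ)) * (C * (t ^ (-(5 / 2 : ℝ)) * (2 : ℝ) ^ (-(10 * (j : ℝ))))) := by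
        rw [hT1] at hC'
        gcongr
    _ = C * ((2 : ℝ) ^ (5 * (j : ℝ)) * (2 : ℝ) ^ (-(10 * (j : ℝ)))) * t ^ (-(5 / 2 : ℝ)) := by
        ring
    _ = _ := by
        rw [← Real.rpow_add two_pos]
        congr 3
        ring

/-- Inserting `χ`, which is `1` wherever `φ` is nonzero, does not affect `f_j` but makes the symbol
compactly supported, so that its kernel is Schwartz. -/
theorem biharmonicFlow_dyadicPiece_eq {φ χ : R5 → ℝ} (hφ : IsLittlewoodPaley φ)
    (hχ : ContDiff ℝ ∞ χ) (hχs : ∀ w, χ w ≠ 0 → 1 / 2 ≤ ‖w‖ ∧ ‖w‖ ≤ 3)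
    (hχφ : ∀ w, 3 / 4 < ‖w‖ → ‖w‖ < 8 / 3 → χ w = 1) (j : ℤ) (t : ℝ) (f : 𝓢'(R5, ℂ)) :
    biharmonicFlow t (dyadicPiece φ j f) =
      TemperedDistribution.fourierMultiplierCLM ℂ (localizedSymbol χ j t) (dyadicPiece φ j f) := by
  have hM : (localizedSymbol χ j t).HasTemperateGrowth :=
    (hasCompactSupport_localizedSymbol hχs j t).hasTemperateGrowth (contDiff_localizedSymbol hχ j t)
  rw [biharmonicFlow, dyadicPiece, angularMultiplier, angularMultiplier,
    TemperedDistribution.fourierMultiplierCLM_fourierMultiplierCLM_apply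
      (hasTemperateGrowth_dyadicSymbol hφ j) (hasTemperateGrowth_biharmonicSymbol t),
    TemperedDistribution.fourierMultiplierCLM_fourierMultiplierCLM_apply
      (hasTemperateGrowth_dyadicSymbol hφ j) hM]
  congr 1
  congr 1
  funext ξ
  simp only [Pi.mul_apply, localizedSymbol, dyadicSymbol, smul_smul]
  by_cases h : φ (((2 : ℝ) ^ (-j) * (2 * Real.pi)) • ξ) = 0
  · rw [h, Complex.ofReal_zero, zero_mul, zero_mul]
  · obtain ⟨h1, h2⟩ := hφ.support_subset _ h
    rw [hχφ _ h1 h2, Complex.ofReal_one, mul_one]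

open FourierTransform in
/-- Interpolated `L^p → L^{p'}` bound, including the endpoint `p = 1`, for convolution with a
Schwartz kernel whose Fourier transform is bounded by `1`. -/
theorem eLpNorm_schwartzConv_le_of_norm_fourier_le_one {K : 𝓢(R5, ℂ)} {A : ℝ}
    (hA : ∀ x, ‖K x‖ ≤ A) (hD : ∀ ξ, ‖𝓕 K ξ‖ ≤ 1) {p : ℝ} (hp1 : 1 ≤ p) (hp2 : p ≤ 2)
    {g : R5 → ℂ} (hg : MemLp g (ENNReal.ofReal p) volume) :
    eLpNorm (schwartzConv K g) (ENNReal.ofReal p / (ENNReal.ofReal p - 1)) volume ≤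
      ENNReal.ofReal (A ^ ((2 - p) / p)) * eLpNorm g (ENNReal.ofReal p) volume := by
  rcases hp1.eq_or_lt with rfl | hp
  -- In `ℝ≥0∞`, `1 / (1 - 1) = 1 / 0 = ⊤`, the intended conjugate exponent.
  · have h1 : (ENNReal.ofReal 1 / (ENNReal.ofReal 1 - 1)) = ⊤ := by simp
    have h2 : A ^ (((2 : ℝ) - 1) / 1) = A := by norm_num
    rw [h1, h2, ENNReal.ofReal_one]
    exact eLpNormEssSup_le_of_ae_enorm_bound
      (Filter.Eventually.of_forall (enorm_schwartzConv_le_of_bound hA hg.1))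
  · have h1 : ENNReal.ofReal p / (ENNReal.ofReal p - 1) = ENNReal.ofReal (p / (p - 1)) := by
      rw [ENNReal.ofReal_div_of_pos (by linarith), ENNReal.ofReal_sub _ zero_le_one,
        ENNReal.ofReal_one]
    have := eLpNorm_schwartzConv_le hA hD ((Real.holderConjugate_iff_eq_conjExponent hp).2 rfl)
      hp2 hg
    rwa [Real.one_rpow, mul_one, ← h1] at this

end Conclusion

open FourierTransform in
theorem lemma4p2 (φ : R5 → ℝ) (hφ : IsLittlewoodPaley φ) :
    ∃ C : ℝ, 0 < C ∧
      ∀ (p t : ℝ) (j : ℤ) (f : 𝓢'(R5, ℂ)), 1 ≤ p → p ≤ 2 → 1 < t →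
        distLpNorm (ENNReal.ofReal p / (ENNReal.ofReal p - 1))
            (biharmonicFlow t (dyadicPiece φ j f)) ≤
          ENNReal.ofReal (C * (2 : ℝ) ^ (-(5 * (2 - p) * (j : ℝ) / p)) *
              t ^ (-(5 * (2 - p) / (2 * p)))) *
            distLpNorm (ENNReal.ofReal p) (dyadicPiece φ j f) := by
  obtain ⟨χ, hχ, hχs, hχ1, hχφ⟩ := exists_annulus_cutoff
  obtain ⟨C, hC0, hC⟩ := exists_norm_integral_quartic_phase_le hχ hχs
  -- Since `0 ≤ (2 - p)/p ≤ 1`, `max C 1` dominates `C ^ ((2 - p)/p)` for all `p` at once.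
  refine ⟨max C 1, by positivity, fun p t j f hp1 hp2 ht => ?_⟩
  have ht0 : 0 < t := by linarith
  have hp0 : 0 < p := by linarith
  have hp1' : 1 ≤ ENNReal.ofReal p := by simpa using hp1
  set M := localizedSymbol χ j t
  have hMc := hasCompactSupport_localizedSymbol hχs j t
  have hMd := contDiff_localizedSymbol hχ j t
  have hMt : M.HasTemperateGrowth := hMc.hasTemperateGrowth hMd
  set K : 𝓢(R5, ℂ) := 𝓕⁻ (hMc.toSchwartzMap hMd) with hK
  have hKM : ∀ ξ, 𝓕 K ξ = M ξ := fun ξ => by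
    rw [hK, FourierTransform.fourier_fourierInv_eq]
    rfl
  have hKD : ∀ ξ, ‖𝓕 K ξ‖ ≤ 1 := fun ξ => by
    rw [hKM]
    exact norm_localizedSymbol_le hχ1 j t ξ
  have hKA : ∀ z, ‖K z‖ ≤ C * (2 : ℝ) ^ (-(5 * (j : ℝ))) * t ^ (-(5 / 2 : ℝ)) := fun z => by
    rw [hK, SchwartzMap.fourierInv_coe]
    exact norm_fourierInv_localizedSymbol_le hC j ht0 z
  have hconst : (C * (2 : ℝ) ^ (-(5 * (j : ℝ))) * t ^ (-(5 / 2 : ℝ))) ^ ((2 - p) / p) ≤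
      max C 1 * (2 : ℝ) ^ (-(5 * (2 - p) * (j : ℝ) / p)) * t ^ (-(5 * (2 - p) / (2 * p))) := by
    have hθ0 : 0 ≤ (2 - p) / p := div_nonneg (by linarith) hp0.le
    have hθ1 : (2 - p) / p ≤ 1 := (div_le_one hp0).2 (by linarith)
    rw [Real.mul_rpow (by positivity) (by positivity), Real.mul_rpow hC0.le (by positivity),
      ← Real.rpow_mul zero_le_two, ← Real.rpow_mul ht0.le,
      show -(5 * (j : ℝ)) * ((2 - p) / p) = -(5 * (2 - p) * (j : ℝ) / p) by ring,
      show -(5 / 2 : ℝ) * ((2 - p) / p) = -(5 * (2 - p) / (2 * p)) by field_simp]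
    gcongr
    calc C ^ ((2 - p) / p) ≤ (max C 1) ^ ((2 - p) / p) := by
          gcongr
          exact le_max_left _ _
      _ ≤ (max C 1) ^ (1 : ℝ) := Real.rpow_le_rpow_of_exponent_le (le_max_right _ _) hθ1
      _ = _ := Real.rpow_one _
  set c := max C 1 * (2 : ℝ) ^ (-(5 * (2 - p) * (j : ℝ) / p)) * t ^ (-(5 * (2 - p) / (2 * p)))
  have hc0 : ENNReal.ofReal c ≠ 0 := by
    rw [Ne, ENNReal.ofReal_eq_zero, not_le]
    positivity
  unfold distLpNorm
  -- If `f_j` is not in `L^p` the infimum is empty and equals `⊤`; as the constant is nonzero, the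
  -- right side is then still `⊤`.
  simp_rw [ENNReal.mul_iInf_of_ne hc0 ENNReal.ofReal_ne_top]
  refine le_iInf₂ fun g hg => ?_
  have hbound := (eLpNorm_schwartzConv_le_of_norm_fourier_le_one hKA hKD hp1 hp2 hg.1).trans
    (mul_le_mul_left (ENNReal.ofReal_le_ofReal hconst) _)
  refine (iInf₂_le (schwartzConv K g) ⟨⟨aestronglyMeasurable_schwartzConv hg.1.1, ?_⟩,
    fun u => ?_⟩).trans hbound
  · exact hbound.trans_lt (ENNReal.mul_lt_top ENNReal.ofReal_lt_top hg.1.2)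
  · rw [biharmonicFlow_dyadicPiece_eq hφ hχ hχs hχφ]
    exact fourierMultiplierCLM_apply_eq_integral_schwartzConv hMt K hKM hp1' hg.1 hg.2 u
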